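/- Let $d\ge 2$, let $\Omega\subset\mathbb{R}^d$ be a bounded connected open set, and let $\varphi\in C(\partial\Omega)$ be Lipschitz continuous. A function $u\colon\Omega\to\mathbb{R}$ is called a variational solution of the Dirichlet problem with boundary data $\varphi$ if $u$ is harmonic on $\Omega$ and there is an extension $\Phi\in C(\overline{\Omega})$ of $\varphi$ with $\Phi-u\in H^1_0(\Omega)$. Here $H^1(\Omega)$ is the space of $u\in L^2(\Omega)$ whose weak partial derivatives $\partial_1u,\dots,\partial_du$ are in $L^2(\Omega)$, with norm $\bigl(\|u\|_{L^2}^2+\sum_j\|\partial_ju\|_{L^2}^2\bigr)^{1/2}$, and $H^1_0(\Omega)$ is the closure of $C_c^\infty(\Omega)$ in $H^1(\Omega)$. Then there is exactly one variational solution $u_\varphi$, and $u_\varphi\in H^1(\Omega)$; that is, it has finite energy: $\int_\Omega|\nabla u_\varphi|^2\,dx<\infty$. -/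

import Mathlib

open Set Filter Topology MeasureTheory TopologicalSpace
open scoped NNReal ENNReal Distributions

/-- `g` is the weak partial derivative `∂ⱼ u` on the open set `Ω`:
`∫_Ω u ∂ⱼw = - ∫_Ω g w` for every smooth `w` with compact support in `Ω`.
It is used below only for `u` and `g` that are square integrable on `Ω`, so that both integrals
converge. -/
def HasWeakPartialDeriv {d : ℕ} (Ω : Opens (EuclideanSpace ℝ (Fin d))) (j : Fin d)
    (u g : EuclideanSpace ℝ (Fin d) → ℝ) : Prop :=
  ∀ w : 𝓓(Ω, ℝ),
    ∫ x in (Ω : Set (EuclideanSpace ℝ (Fin d))),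
        u x * fderiv ℝ w x (EuclideanSpace.single j 1) =
      - ∫ x in (Ω : Set (EuclideanSpace ℝ (Fin d))), g x * w x

/-- `u ∈ H¹(Ω)` with weak gradient `g = (∂₁u, …, ∂_d u)`: the function `u` and its weak partial
derivatives `g j` belong to `L²(Ω)`. Values outside `Ω` play no role. -/
structure HasH1Gradient {d : ℕ} (Ω : Opens (EuclideanSpace ℝ (Fin d)))
    (u : EuclideanSpace ℝ (Fin d) → ℝ) (g : Fin d → EuclideanSpace ℝ (Fin d) → ℝ) : Prop where
  memLp : MemLp u 2 (volume.restrict (Ω : Set (EuclideanSpace ℝ (Fin d))))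
  memLp_grad : ∀ j, MemLp (g j) 2 (volume.restrict (Ω : Set (EuclideanSpace ℝ (Fin d))))
  weak : ∀ j, HasWeakPartialDeriv Ω j u (g j)

/-- `u ∈ H¹(Ω)`: `u ∈ L²(Ω)` and all first order weak partial derivatives are in `L²(Ω)`. -/
def MemH1 {d : ℕ} (Ω : Opens (EuclideanSpace ℝ (Fin d)))
    (u : EuclideanSpace ℝ (Fin d) → ℝ) : Prop :=
  ∃ g, HasH1Gradient Ω u g

/-- `v ∈ H¹₀(Ω)`, the closure of `C_c^∞(Ω)` in `H¹(Ω)`: `v ∈ H¹(Ω)`, and there are test functions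
`w n` such that `w n → v` and `∂ⱼ (w n) → ∂ⱼ v` in `L²(Ω)` for all `j`, that is, `w n → v` in the
norm of `H¹(Ω)`. -/
def MemH10 {d : ℕ} (Ω : Opens (EuclideanSpace ℝ (Fin d)))
    (v : EuclideanSpace ℝ (Fin d) → ℝ) : Prop :=
  ∃ g : Fin d → EuclideanSpace ℝ (Fin d) → ℝ, HasH1Gradient Ω v g ∧
    ∃ w : ℕ → 𝓓(Ω, ℝ),
      Tendsto (fun n => eLpNorm (fun x => w n x - v x) 2
        (volume.restrict (Ω : Set (EuclideanSpace ℝ (Fin d))))) atTop (𝓝 0) ∧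
      ∀ j, Tendsto
        (fun n => eLpNorm (fun x => fderiv ℝ (w n) x (EuclideanSpace.single j 1) - g j x) 2
          (volume.restrict (Ω : Set (EuclideanSpace ℝ (Fin d))))) atTop (𝓝 0)

/-- `u` (restricted to `Ω`) is a variational solution of the Dirichlet problem with boundary data
`φ ∈ C(∂Ω)`: it is harmonic on `Ω`, and there is an extension `Φ ∈ C(closure Ω)` of `φ` such that
`Φ - u ∈ H¹₀(Ω)`. Only the values of `u` on `Ω` and those of `Φ` on `closure Ω` matter. -/
def IsVariationalSolution {d : ℕ} (Ω : Opens (EuclideanSpace ℝ (Fin d)))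
    (φ : C(frontier (Ω : Set (EuclideanSpace ℝ (Fin d))), ℝ))
    (u : EuclideanSpace ℝ (Fin d) → ℝ) : Prop :=
  InnerProductSpace.HarmonicOnNhd u (Ω : Set (EuclideanSpace ℝ (Fin d))) ∧
    ∃ Φ : EuclideanSpace ℝ (Fin d) → ℝ,
      ContinuousOn Φ (closure (Ω : Set (EuclideanSpace ℝ (Fin d)))) ∧
      (∀ z : frontier (Ω : Set (EuclideanSpace ℝ (Fin d))), Φ z = φ z) ∧
      MemH10 Ω (fun x => Φ x - u x)

/-!
Existence is Dirichlet's principle: extend `φ` to a Lipschitz function `Φ` and subtract from `Φ` the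
element `v` of `H¹₀(Ω)` whose gradient is the orthogonal projection of `∇Φ` onto the closure of the
gradients of test functions. Then `Φ - v` is weakly harmonic and of finite energy, and by Weyl's
lemma it is harmonic: its convolutions with the dilates of a radial kernel do not depend on the
dilation.

Uniqueness is a weak maximum principle. Two variational solutions need not come from extensions
whose difference has finite energy, so testing with the positive part of the difference `u` of the
solutions is not possible directly. Instead the harmonic `u` is tested with `G(u + w) η`, where `G`
is a `C¹` positive part, `w` is a test function approximating `Ψ - u ∈ H¹₀(Ω)`, and `η` is a cutoff
equal to `1` where the boundary-negative function `Ψ` is nonnegative.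
-/

open scoped ContDiff Laplacian LineDeriv Convolution
open ContinuousLinearMap (mul mul_apply')
open Module (finrank)

section Weyl

variable {E : Type*} [NormedAddCommGroup E] [InnerProductSpace ℝ E]

section Laplacian

theorem hasFDerivAt_comp_mul_norm_sub_sq {F : ℝ → ℝ} (hF : Differentiable ℝ F) (a : ℝ) (c x : E) :
    HasFDerivAt (fun y => F (a * ‖y - c‖ ^ 2))
      (deriv F (a * ‖x - c‖ ^ 2) • (2 * a) • innerSL ℝ (x - c)) x := by
  have hnorm : HasFDerivAt (fun y => a * ‖y - c‖ ^ 2) ((2 * a) • innerSL ℝ (x - c)) x := by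
    refine (((hasFDerivAt_id x).sub_const c).norm_sq.const_mul a).congr_fderiv ?_
    ext v
    simp [two_mul, add_mul, mul_add]
  exact (hF _).hasDerivAt.comp_hasFDerivAt x hnorm

theorem contDiff_comp_mul_norm_sub_sq {n : ℕ∞ω} {F : ℝ → ℝ} (hF : ContDiff ℝ n F) (a : ℝ)
    (c : E) : ContDiff ℝ n fun y => F (a * ‖y - c‖ ^ 2) :=
  hF.comp (contDiff_const.mul ((contDiff_id.sub contDiff_const).norm_sq ℝ))

variable [FiniteDimensional ℝ E]

theorem laplacian_eq_sum_fderiv {ι : Type*} [Fintype ι] (b : OrthonormalBasis ι ℝ E) {f : E → ℝ}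
    {x : E} (hf : ContDiffAt ℝ 2 f x) :
    Δ f x = ∑ i, fderiv ℝ (fun y => fderiv ℝ f y (b i)) x (b i) := by
  have hf' : DifferentiableAt ℝ (fderiv ℝ f) x :=
    (hf.fderiv_right (m := 1) (by norm_num)).differentiableAt one_ne_zero
  simp_rw [InnerProductSpace.laplacian_eq_iteratedFDeriv_orthonormalBasis f b,
    iteratedFDeriv_two_apply, fderiv_clm_apply hf' (differentiableAt_const _)]
  simp

theorem laplacian_comp_mul_norm_sub_sq {F : ℝ → ℝ} (hF : ContDiff ℝ 2 F) (a : ℝ) (c x : E) :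
    Δ (fun y => F (a * ‖y - c‖ ^ 2)) x =
      4 * a ^ 2 * ‖x - c‖ ^ 2 * deriv (deriv F) (a * ‖x - c‖ ^ 2)
        + 2 * a * finrank ℝ E * deriv F (a * ‖x - c‖ ^ 2) := by
  have hF' : ContDiff ℝ 1 (deriv F) :=
    ContDiff.deriv' (show ContDiff ℝ (1 + 1) F by simpa [one_add_one_eq_two] using hF)
  let b := stdOrthonormalBasis ℝ E
  have hsecond (i) : fderiv ℝ (fun y => fderiv ℝ (fun y => F (a * ‖y - c‖ ^ 2)) y (b i)) x (b i) =
      4 * a ^ 2 * deriv (deriv F) (a * ‖x - c‖ ^ 2) * inner ℝ (x - c) (b i) ^ 2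
        + 2 * a * deriv F (a * ‖x - c‖ ^ 2) := by
    have hfirst (y : E) : fderiv ℝ (fun y => F (a * ‖y - c‖ ^ 2)) y (b i) =
        deriv F (a * ‖y - c‖ ^ 2) * (2 * a * inner ℝ (b i) (y - c)) := by
      rw [(hasFDerivAt_comp_mul_norm_sub_sq (hF.differentiable two_ne_zero) a c y).fderiv]
      simp [real_inner_comm, inner_sub_left]
    have hinner : HasFDerivAt (fun y => 2 * a * inner ℝ (b i) (y - c))
        ((2 * a) • innerSL ℝ (b i)) x :=
      ((innerSL ℝ (b i)).hasFDerivAt.comp x ((hasFDerivAt_id x).sub_const c)).const_mul (2 * a)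
    simp_rw [hfirst]
    rw [((hasFDerivAt_comp_mul_norm_sub_sq (hF'.differentiable one_ne_zero) a c x).fun_mul
      hinner).fderiv]
    simp [real_inner_comm, inner_sub_left]
    ring
  rw [laplacian_eq_sum_fderiv b (contDiff_comp_mul_norm_sub_sq hF a c).contDiffAt,
    Finset.sum_congr rfl fun i _ => hsecond i, Finset.sum_add_distrib, ← Finset.mul_sum,
    b.sum_sq_inner_left]
  simp
  ring

end Laplacian

section Convolution

variable [MeasurableSpace E] [BorelSpace E] [FiniteDimensional ℝ E]

theorem fderiv_convolution_mul_apply {f k : E → ℝ} (hf : LocallyIntegrable f)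
    (hk : ContDiff ℝ 1 k) (hkc : HasCompactSupport k) (v x : E) :
    fderiv ℝ (f ⋆[mul ℝ ℝ] k) x v = (f ⋆[mul ℝ ℝ] fun y => fderiv ℝ k y v) x := by
  rw [(hkc.hasFDerivAt_convolution_right _ hf hk x).fderiv,
    convolution_precompR_apply _ hf (hkc.fderiv ℝ) (hk.continuous_fderiv one_ne_zero)]

theorem laplacian_convolution_mul {f k : E → ℝ} (hf : LocallyIntegrable f) (hk : ContDiff ℝ 2 k)
    (hkc : HasCompactSupport k) :
    Δ (f ⋆[mul ℝ ℝ] k) = f ⋆[mul ℝ ℝ] Δ k := by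
  let b := stdOrthonormalBasis ℝ E
  have hk' (v : E) : ContDiff ℝ 1 fun y => fderiv ℝ k y v :=
    (hk.fderiv_right (m := 1) (by norm_num)).clm_apply contDiff_const
  have hsecond (x : E) (i) :
      fderiv ℝ (fun y => fderiv ℝ (f ⋆[mul ℝ ℝ] k) y (b i)) x (b i) =
        ∫ y, f y * fderiv ℝ (fun z => fderiv ℝ k z (b i)) (x - y) (b i) := by
    simp_rw [fderiv_convolution_mul_apply hf (hk.of_le one_le_two) hkc]
    exact fderiv_convolution_mul_apply hf (hk' _) (hkc.fderiv_apply ℝ _) _ _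
  ext x
  simp_rw [laplacian_eq_sum_fderiv b (hkc.contDiff_convolution_right (n := 2) _ hf hk).contDiffAt,
    hsecond]
  rw [← integral_finsetSum]
  · simp_rw [convolution_def, laplacian_eq_sum_fderiv b hk.contDiffAt, ← Finset.mul_sum]
    rfl
  · exact fun i _ => ((hkc.fderiv_apply ℝ _).fderiv_apply ℝ _).convolutionExists_right (mul ℝ ℝ) hf
      (((hk' _).continuous_fderiv one_ne_zero).clm_apply continuous_const) x

theorem hasDerivAt_convolution_mul_param {f : E → ℝ} (hf : LocallyIntegrable f) {k : ℝ → E → ℝ}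
    (hk : ContDiff ℝ 1 (Function.uncurry k)) {s : Set ℝ} (hs : IsOpen s) {K : Set E}
    (hK : IsCompact K) (hkK : ∀ r ∈ s, ∀ y ∉ K, k r y = 0) {t : ℝ} (ht : t ∈ s) (x : E) :
    HasDerivAt (fun r => (f ⋆[mul ℝ ℝ] k r) x)
      (∫ y, f y * deriv (fun r => k r (x - y)) t) t := by
  have hline (y : E) : HasDerivAt (fun r : ℝ => (r, y)) ((1 : ℝ), (0 : E)) t :=
    (hasDerivAt_id t).prodMk (hasDerivAt_const t y)
  have hpartial (y : E) :
      fderiv ℝ (Function.uncurry k) (t, y) (1, 0) = deriv (fun r => k r y) t :=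
    ((hk.differentiable one_ne_zero (t, y)).hasFDerivAt.comp_hasDerivAt t (hline y)).deriv.symm
  have hcont : Continuous fun y => fderiv ℝ (Function.uncurry k) (t, y) :=
    (hk.continuous_fderiv one_ne_zero).comp (by fun_prop)
  have hsupp : HasCompactSupport fun y => fderiv ℝ (Function.uncurry k) (t, y) := by
    refine HasCompactSupport.intro hK fun y hy => ?_
    have hzero : Function.uncurry k =ᶠ[𝓝 (t, y)] fun _ => 0 := by
      filter_upwards [(hs.prod hK.isClosed.isOpen_compl).mem_nhds ⟨ht, hy⟩] with q hq
        using hkK q.1 hq.1 q.2 hq.2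
    simp [hzero.fderiv_eq]
  have hderiv := hasFDerivAt_convolution_right_with_param (mul ℝ ℝ) hs hK
    (fun p y hp hy => hkK p hp y hy) hf hk.contDiffOn (t, x) ht
  refine (hderiv.comp_hasDerivAt t (hline x)).congr_deriv ?_
  refine (convolution_precompR_apply (mul ℝ ℝ) hf hsupp hcont x ((1 : ℝ), (0 : E))).trans ?_
  simp_rw [convolution_def, hpartial, mul_apply']

end Convolution

section RadialKernel

variable {F : ℝ → ℝ}

/-- The dilates `tⁿ F'(t² |y|²)`, `n = dim E`, of a radial mollifier; they have the same integral
for all `t > 0`. The profile is written as a derivative because the `t`-derivative of the kernel is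
then a multiple of the Laplacian of `F(t² |y|²)`. -/
noncomputable def radialKernel (F : ℝ → ℝ) (t : ℝ) (y : E) : ℝ :=
  t ^ finrank ℝ E * deriv F (t ^ 2 * ‖y‖ ^ 2)

theorem contDiff_uncurry_radialKernel (hF : ContDiff ℝ ∞ F) :
    ContDiff ℝ ∞ (Function.uncurry (radialKernel (E := E) F)) :=
  (contDiff_fst.pow _).mul ((contDiff_infty_iff_deriv.1 hF).2.comp
    ((contDiff_fst.pow 2).mul (contDiff_snd.norm_sq ℝ)))

theorem contDiff_radialKernel (hF : ContDiff ℝ ∞ F) (t : ℝ) :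
    ContDiff ℝ ∞ (radialKernel (E := E) F t) :=
  (contDiff_uncurry_radialKernel hF).comp (contDiff_const.prodMk contDiff_id)

theorem deriv_eq_zero_of_forall_lt {a s : ℝ} (hF : ∀ s, a < s → F s = 0) (hs : a < s) :
    deriv F s = 0 := by
  have hzero : F =ᶠ[𝓝 s] fun _ => 0 := by
    filter_upwards [lt_mem_nhds hs] with r hr using hF r hr
  rw [hzero.deriv_eq, deriv_const]

theorem comp_mul_norm_sub_sq_eq_zero {V : Type*} [SeminormedAddCommGroup V]
    (hF : ∀ s, 1 < s → F s = 0) {t T : ℝ} (hT : 0 < T) (hTt : T ≤ t) {c y : V}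
    (hy : y ∉ Metric.closedBall c (1 / T)) :
    F (t ^ 2 * ‖y - c‖ ^ 2) = 0 := by
  rw [Metric.mem_closedBall, dist_eq_norm, not_le, div_lt_iff₀ hT] at hy
  refine hF _ ?_
  rw [← mul_pow]
  exact one_lt_pow₀ (by nlinarith [norm_nonneg (y - c)]) two_ne_zero

theorem radialKernel_eq_zero (hF : ∀ s, 1 < s → F s = 0) {t T : ℝ} (hT : 0 < T) (hTt : T ≤ t)
    {y : E} (hy : y ∉ Metric.closedBall 0 (1 / T)) : radialKernel F t y = 0 := by
  simpa [radialKernel] using Or.inr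
    (comp_mul_norm_sub_sq_eq_zero (fun _ => deriv_eq_zero_of_forall_lt hF) hT hTt hy)

theorem radialKernel_eq_pow_mul (F : ℝ → ℝ) (t : ℝ) (y : E) :
    radialKernel F t y = t ^ finrank ℝ E * radialKernel F 1 (t • y) := by
  simp [radialKernel, norm_smul, mul_pow]

theorem deriv_radialKernel [FiniteDimensional ℝ E] (hF : ContDiff ℝ ∞ F) {t : ℝ} (ht : 0 < t)
    (y : E) :
    deriv (fun r => radialKernel F r y) t =
      t ^ finrank ℝ E / (2 * t ^ 3) * Δ (fun z : E => F (t ^ 2 * ‖z‖ ^ 2)) y := by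
  have hF' : Differentiable ℝ (deriv F) :=
    (contDiff_infty_iff_deriv.1 hF).2.differentiable (by simp)
  have hinner : HasDerivAt (fun r : ℝ => r ^ 2 * ‖y‖ ^ 2) (2 * t * ‖y‖ ^ 2) t := by
    simpa using (hasDerivAt_pow 2 t).mul_const (‖y‖ ^ 2)
  have hΔ := laplacian_comp_mul_norm_sub_sq (contDiff_infty.1 hF 2) (t ^ 2) 0 y
  simp only [sub_zero] at hΔ
  rw [hΔ]
  refine ((hasDerivAt_pow _ t).fun_mul ((hF' _).hasDerivAt.comp t hinner)).deriv.trans ?_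
  rcases finrank ℝ E with _ | n
  all_goals
    field_simp
    simp
    ring_nf

variable [FiniteDimensional ℝ E]

theorem hasCompactSupport_radialKernel (hF : ∀ s, 1 < s → F s = 0) {t : ℝ} (ht : 0 < t) :
    HasCompactSupport (radialKernel (E := E) F t) :=
  HasCompactSupport.intro (isCompact_closedBall 0 (1 / t)) fun _ =>
    radialKernel_eq_zero hF ht le_rfl

variable [MeasurableSpace E] [BorelSpace E]

theorem integral_radialKernel (F : ℝ → ℝ) {t : ℝ} (ht : 0 < t) :
    ∫ y : E, radialKernel F t y = ∫ y : E, radialKernel F 1 y := by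
  simp_rw [radialKernel_eq_pow_mul F t]
  rw [integral_const_mul, Measure.integral_comp_smul, abs_of_pos (by positivity), smul_eq_mul,
    mul_inv_cancel_left₀ (by positivity)]

variable (E) in
theorem exists_integral_radialKernel_eq_one :
    ∃ F : ℝ → ℝ, ContDiff ℝ ∞ F ∧ (∀ s, 1 < s → F s = 0) ∧
      ∫ y : E, radialKernel F 1 y = 1 := by
  let G : ℝ → ℝ := fun s => -expNegInvGlue (1 - s)
  have hG : ContDiff ℝ ∞ G := (expNegInvGlue.contDiff.comp (contDiff_const.sub contDiff_id)).neg
  have hG_zero (s : ℝ) (hs : 1 < s) : G s = 0 := by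
    simp [G, expNegInvGlue.zero_of_nonpos (sub_nonpos.2 hs.le)]
  have hG_mono : Monotone G := fun x y hxy => neg_le_neg (expNegInvGlue.monotone (by linarith))
  have hG_deriv : HasDerivAt G (expNegInvGlue 1) 0 := by
    have h := expNegInvGlue.hasDerivAt_polynomial_eval_inv_mul 1 (1 - (0 : ℝ))
    simp only [Polynomial.eval_one, one_mul] at h
    exact (h.scomp (0 : ℝ) ((hasDerivAt_id (0 : ℝ)).const_sub 1)).neg.congr_deriv (by simp)
  have hpos : 0 < ∫ y : E, radialKernel G 1 y := by
    refine (contDiff_radialKernel hG 1).continuous.integral_pos_of_hasCompactSupport_nonneg_nonzero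
      (hasCompactSupport_radialKernel hG_zero one_pos) (fun y => ?_) (x := 0) ?_
    · simp [radialKernel, hG_mono.deriv_nonneg]
    · simp [radialKernel, hG_deriv.deriv, (expNegInvGlue.pos_of_pos one_pos).ne']
  refine ⟨fun s => (∫ y : E, radialKernel G 1 y)⁻¹ * G s, contDiff_const.mul hG,
    fun s hs => by simp only [hG_zero s hs, mul_zero], ?_⟩
  calc ∫ y : E, radialKernel (fun s => (∫ y : E, radialKernel G 1 y)⁻¹ * G s) 1 y
      = ∫ y : E, (∫ y : E, radialKernel G 1 y)⁻¹ * radialKernel G 1 y := by simp [radialKernel]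
    _ = 1 := by rw [integral_const_mul, inv_mul_cancel₀ hpos.ne']

end RadialKernel

section WeaklyHarmonic

variable [FiniteDimensional ℝ E] [MeasurableSpace E] [BorelSpace E]

/-- `f` is harmonic on the open set `U` in the sense of distributions. -/
def IsWeaklyHarmonicOn (f : E → ℝ) (U : Opens E) : Prop :=
  ∀ w : 𝓓(U, ℝ), ∫ x, f x * Δ (w : E → ℝ) x = 0

namespace IsWeaklyHarmonicOn

variable {U : Opens E} {f : E → ℝ} {F : ℝ → ℝ} {x : E} {t T : ℝ}

theorem integral_mul_laplacian_radial (hfU : IsWeaklyHarmonicOn f U) (hF : ContDiff ℝ ∞ F)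
    (hF1 : ∀ s, 1 < s → F s = 0) (ht : 0 < t) (hx : Metric.closedBall x (1 / t) ⊆ U) :
    ∫ y, f y * Δ (fun z : E => F (t ^ 2 * ‖z‖ ^ 2)) (x - y) = 0 := by
  have hsupp : Function.support (fun y => F (t ^ 2 * ‖y - x‖ ^ 2)) ⊆
      Metric.closedBall x (1 / t) := fun y hy => by
    by_contra h
    exact hy (comp_mul_norm_sub_sq_eq_zero hF1 ht le_rfl h)
  let w : 𝓓(U, ℝ) :=
    ⟨fun y => F (t ^ 2 * ‖y - x‖ ^ 2), contDiff_comp_mul_norm_sub_sq hF (t ^ 2) x,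
      HasCompactSupport.of_support_subset_isCompact (isCompact_closedBall x (1 / t)) hsupp,
      (closure_minimal hsupp Metric.isClosed_closedBall).trans hx⟩
  refine (integral_congr_ae (.of_forall fun y => ?_)).trans (hfU w)
  have hreflect := laplacian_comp_mul_norm_sub_sq (contDiff_infty.1 hF 2) (t ^ 2) 0 (x - y)
  simp only [sub_zero] at hreflect
  change f y * _ = f y * Δ (fun y => F (t ^ 2 * ‖y - x‖ ^ 2)) y
  rw [hreflect, laplacian_comp_mul_norm_sub_sq (contDiff_infty.1 hF 2), norm_sub_rev]

theorem hasDerivAt_convolution_radialKernel (hfU : IsWeaklyHarmonicOn f U)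
    (hf : LocallyIntegrable f) (hF : ContDiff ℝ ∞ F) (hF1 : ∀ s, 1 < s → F s = 0) (ht : 0 < t)
    (hx : Metric.closedBall x (1 / t) ⊆ U) :
    HasDerivAt (fun r => (f ⋆[mul ℝ ℝ] radialKernel F r) x) 0 t := by
  refine (hasDerivAt_convolution_mul_param hf
    ((contDiff_uncurry_radialKernel hF).of_le (mod_cast le_top)) isOpen_Ioi
    (isCompact_closedBall 0 (1 / (t / 2)))
    (fun r hr _ => radialKernel_eq_zero hF1 (half_pos ht) (le_of_lt hr)) (half_lt_self ht)
    x).congr_deriv ?_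
  simp_rw [deriv_radialKernel hF ht, mul_left_comm (f _)]
  rw [integral_const_mul, hfU.integral_mul_laplacian_radial hF hF1 ht hx, mul_zero]

theorem convolution_radialKernel_eq (hfU : IsWeaklyHarmonicOn f U) (hf : LocallyIntegrable f)
    (hF : ContDiff ℝ ∞ F) (hF1 : ∀ s, 1 < s → F s = 0) (hT : 0 < T)
    (hx : Metric.closedBall x (1 / T) ⊆ U) (hTt : T ≤ t) :
    (f ⋆[mul ℝ ℝ] radialKernel F t) x = (f ⋆[mul ℝ ℝ] radialKernel F T) x := by
  have hderiv (r : ℝ) (hr : T ≤ r) :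
      HasDerivAt (fun r => (f ⋆[mul ℝ ℝ] radialKernel F r) x) 0 r :=
    hfU.hasDerivAt_convolution_radialKernel hf hF hF1 (hT.trans_le hr)
      ((Metric.closedBall_subset_closedBall (one_div_le_one_div_of_le hT hr)).trans hx)
  exact constant_of_has_deriv_right_zero
    (fun r hr => (hderiv r hr.1).continuousAt.continuousWithinAt)
    (fun r hr => (hderiv r hr.1).hasDerivWithinAt) t ⟨hTt, le_rfl⟩

theorem laplacian_convolution_radialKernel (hfU : IsWeaklyHarmonicOn f U)
    (hf : LocallyIntegrable f) (hF : ContDiff ℝ ∞ F) (hF1 : ∀ s, 1 < s → F s = 0) (ht : 0 < t)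
    (hx : Metric.closedBall x (1 / t) ⊆ U) :
    Δ (f ⋆[mul ℝ ℝ] radialKernel F t) x = 0 := by
  rw [laplacian_convolution_mul hf (contDiff_infty.1 (contDiff_radialKernel hF t) 2)
    (hasCompactSupport_radialKernel hF1 ht)]
  exact hfU.integral_mul_laplacian_radial (F := fun s => t ^ finrank ℝ E * deriv F s)
    (contDiff_const.mul (contDiff_infty_iff_deriv.1 hF).2)
    (fun s hs => by simp only [deriv_eq_zero_of_forall_lt hF1 hs, mul_zero]) ht hx

end IsWeaklyHarmonicOn

theorem ae_tendsto_convolution_radialKernel {f : E → ℝ} (hf : LocallyIntegrable f) {F : ℝ → ℝ}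
    (hF : ContDiff ℝ ∞ F) (hF1 : ∀ s, 1 < s → F s = 0) (hFint : ∫ y : E, radialKernel F 1 y = 1) :
    ∀ᵐ x, Tendsto (fun t => (f ⋆[mul ℝ ℝ] radialKernel F t) x) atTop (𝓝 (f x)) := by
  obtain ⟨C, hC⟩ :=
    (contDiff_radialKernel (E := E) hF 1).continuous.bounded_above_of_compact_support
    (hasCompactSupport_radialKernel hF1 one_pos)
  have hradius : Tendsto (fun t : ℝ => 1 / t) atTop (𝓝[>] 0) := by
    simpa using tendsto_inv_atTop_nhdsGT_zero
  filter_upwards [(Besicovitch.vitaliFamily volume).ae_tendsto_average_norm_sub hf] with x hx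
  have hlim := tendsto_integral_smul_of_tendsto_average_norm_sub
    (g := fun (t : ℝ) y => radialKernel F t (x - y))
    (C * volume.real (Metric.closedBall (0 : E) 1))
    ((hx.comp (Besicovitch.tendsto_filterAt volume x)).comp hradius)
    (.of_forall fun t => hf.integrableOn_isCompact (isCompact_closedBall _ _)) ?_ ?_ ?_
  · refine hlim.congr fun t => ?_
    simp_rw [convolution_def, mul_apply', smul_eq_mul, mul_comm (f _)]
  · refine tendsto_const_nhds.congr' ?_
    filter_upwards [eventually_gt_atTop 0] with t ht
    rw [integral_sub_left_eq_self (radialKernel F t), integral_radialKernel F ht, hFint]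
  · filter_upwards [eventually_gt_atTop 0] with t ht y hy
    by_contra h
    refine hy (radialKernel_eq_zero hF1 ht le_rfl ?_)
    rwa [Metric.mem_closedBall, dist_zero_right, ← dist_eq_norm, dist_comm]
  · filter_upwards [eventually_gt_atTop 0] with t ht y
    have hball : 0 < volume.real (Metric.closedBall (0 : E) 1) :=
      ENNReal.toReal_pos (Metric.measure_closedBall_pos _ _ one_pos).ne'
        measure_closedBall_lt_top.ne
    calc |radialKernel F t (x - y)| = t ^ finrank ℝ E * |radialKernel F 1 (t • (x - y))| := by
          rw [radialKernel_eq_pow_mul, abs_mul, abs_of_pos (pow_pos ht _)]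
      _ ≤ t ^ finrank ℝ E * C := by gcongr; exact hC _
      _ = _ := by
          rw [Measure.addHaar_real_closedBall' _ x (by positivity), one_div, inv_pow]
          field_simp

/-- **Weyl's lemma**. -/
theorem IsWeaklyHarmonicOn.exists_harmonicOnNhd_ae_eq {f : E → ℝ} {U : Opens E}
    (hfU : IsWeaklyHarmonicOn f U) (hf : LocallyIntegrable f) :
    ∃ u : E → ℝ, InnerProductSpace.HarmonicOnNhd u U ∧ u =ᵐ[volume.restrict U] f := by
  obtain ⟨F, hF, hF1, hFint⟩ := exists_integral_radialKernel_eq_one E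
  refine ⟨fun x => limUnder atTop fun t => (f ⋆[mul ℝ ℝ] radialKernel F t) x, fun x hx => ?_, ?_⟩
  · obtain ⟨r, hr, hrU⟩ := Metric.isOpen_iff.1 U.isOpen x hx
    have hball (y : E) (hy : y ∈ Metric.ball x (r / 2)) :
        Metric.closedBall y (1 / (4 / r)) ⊆ U := by
      refine (Metric.closedBall_subset_ball' ?_).trans hrU
      rw [Metric.mem_ball] at hy
      rw [one_div_div]
      linarith
    have hr4 : 0 < 4 / r := by positivity
    have hnhds : Metric.ball x (r / 2) ∈ 𝓝 x := Metric.ball_mem_nhds x (half_pos hr)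
    have heq : (fun y => limUnder atTop fun t => (f ⋆[mul ℝ ℝ] radialKernel F t) y) =ᶠ[𝓝 x]
        f ⋆[mul ℝ ℝ] radialKernel F (4 / r) := by
      filter_upwards [hnhds] with y hy
      refine (tendsto_const_nhds.congr' ?_).limUnder_eq
      filter_upwards [eventually_ge_atTop (4 / r)] with t ht
        using (hfU.convolution_radialKernel_eq hf hF hF1 hr4 (hball y hy) ht).symm
    rw [InnerProductSpace.harmonicAt_congr_nhds heq]
    refine ⟨((hasCompactSupport_radialKernel hF1 hr4).contDiff_convolution_right (n := 2) _ hf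
      (contDiff_infty.1 (contDiff_radialKernel hF _) 2)).contDiffAt, ?_⟩
    filter_upwards [hnhds] with y hy
      using hfU.laplacian_convolution_radialKernel hf hF hF1 hr4 (hball y hy)
  · filter_upwards [ae_restrict_of_ae (ae_tendsto_convolution_radialKernel hf hF hF1 hFint)]
      with x hx using hx.limUnder_eq

end WeaklyHarmonic

end Weyl

section L2

variable {α : Type*} [MeasurableSpace α] {μ : Measure α} {f k : ℕ → α → ℝ} {f₀ k₀ : α → ℝ}

theorem inner_toLp_toLp {f g : α → ℝ} (hf : MemLp f 2 μ) (hg : MemLp g 2 μ) :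
    inner ℝ (hf.toLp f) (hg.toLp g) = ∫ x, f x * g x ∂μ := by
  rw [L2.inner_def]
  refine integral_congr_ae ?_
  filter_upwards [hf.coeFn_toLp, hg.coeFn_toLp] with x hfx hgx
  simp [hfx, hgx, mul_comm]

/-- Convergence in `L²(μ)` of a sequence of real functions, membership in `L²(μ)` included. -/
structure TendstoL2 (μ : Measure α) (f : ℕ → α → ℝ) (f₀ : α → ℝ) : Prop where
  memLp : ∀ n, MemLp (f n) 2 μ
  memLp_lim : MemLp f₀ 2 μ
  tendsto : Tendsto (fun n => eLpNorm (fun x => f n x - f₀ x) 2 μ) atTop (𝓝 0)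

theorem tendstoL2_const (hf : MemLp f₀ 2 μ) : TendstoL2 μ (fun _ => f₀) f₀ :=
  ⟨fun _ => hf, hf, by simp⟩

theorem tendstoL2_of_tendsto_toLp (hf : ∀ n, MemLp (f n) 2 μ) {g : Lp ℝ 2 μ}
    (h : Tendsto (fun n => (hf n).toLp (f n)) atTop (𝓝 g)) : TendstoL2 μ f g := by
  refine ⟨hf, Lp.memLp g,
    (Lp.tendsto_Lp_iff_tendsto_eLpNorm' _ _ |>.1 h).congr fun n => eLpNorm_congr_ae ?_⟩
  filter_upwards [(hf n).coeFn_toLp] with x hx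
  simp [hx]

namespace TendstoL2

theorem congr_lim_ae (h : TendstoL2 μ f f₀) (hk : f₀ =ᵐ[μ] k₀) : TendstoL2 μ f k₀ := by
  refine ⟨h.memLp, (memLp_congr_ae hk).1 h.memLp_lim, h.tendsto.congr fun n => eLpNorm_congr_ae ?_⟩
  filter_upwards [hk] with x hx
  rw [hx]

theorem sub (hf : TendstoL2 μ f f₀) (hk : TendstoL2 μ k k₀) :
    TendstoL2 μ (fun n x => f n x - k n x) (fun x => f₀ x - k₀ x) where
  memLp n := (hf.memLp n).sub (hk.memLp n)
  memLp_lim := hf.memLp_lim.sub hk.memLp_lim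
  tendsto := by
    refine tendsto_of_tendsto_of_tendsto_of_le_of_le tendsto_const_nhds
      (by simpa using hf.tendsto.add hk.tendsto) (fun _ => zero_le) fun n => ?_
    refine (eLpNorm_congr_ae (.of_forall fun x => sub_sub_sub_comm ..)).trans_le ?_
    exact eLpNorm_sub_le ((hf.memLp n).sub hf.memLp_lim).1 ((hk.memLp n).sub hk.memLp_lim).1
      one_le_two

theorem mul_right (hf : TendstoL2 μ f f₀) {b : α → ℝ} (hb : MemLp b ∞ μ) :
    TendstoL2 μ (fun n x => f n x * b x) (fun x => f₀ x * b x) where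
  memLp n := MemLp.mul' (p := 2) (q := ∞) hb (hf.memLp n)
  memLp_lim := MemLp.mul' (p := 2) (q := ∞) hb hf.memLp_lim
  tendsto := by
    have hlim := ENNReal.Tendsto.mul_const (b := eLpNorm b ∞ μ) hf.tendsto (.inr hb.2.ne)
    rw [zero_mul] at hlim
    refine tendsto_of_tendsto_of_tendsto_of_le_of_le tendsto_const_nhds hlim
      (fun _ => zero_le) fun n => ?_
    refine (eLpNorm_congr_ae (.of_forall fun x => (sub_mul ..).symm)).trans_le ?_
    exact eLpNorm_smul_le_eLpNorm_mul_eLpNorm_top 2 b (φ := fun x => f n x - f₀ x)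
      ((hf.memLp n).sub hf.memLp_lim).1

theorem comp_lipschitzWith (hf : TendstoL2 μ f f₀) {G : ℝ → ℝ} {C : ℝ≥0} (hG : LipschitzWith C G)
    (hG0 : G 0 = 0) : TendstoL2 μ (fun n x => G (f n x)) (fun x => G (f₀ x)) where
  memLp n := hG.comp_memLp hG0 (hf.memLp n)
  memLp_lim := hG.comp_memLp hG0 hf.memLp_lim
  tendsto := by
    have hlim := ENNReal.Tendsto.const_mul (a := (C : ℝ≥0∞)) hf.tendsto (.inr ENNReal.coe_ne_top)
    rw [mul_zero] at hlim
    refine tendsto_of_tendsto_of_tendsto_of_le_of_le tendsto_const_nhds hlim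
      (fun _ => zero_le) fun n => ?_
    exact eLpNorm_le_nnreal_smul_eLpNorm_of_ae_le_mul
      (.of_forall fun x => by
        simpa only [Real.dist_eq, ← Real.norm_eq_abs] using! hG.dist_le_mul (f n x) (f₀ x)) 2

theorem tendsto_toLp (h : TendstoL2 μ f f₀) :
    Tendsto (fun n => (h.memLp n).toLp (f n)) atTop (𝓝 (h.memLp_lim.toLp f₀)) :=
  (Lp.tendsto_Lp_iff_tendsto_eLpNorm'' _ h.memLp _ h.memLp_lim).2 h.tendsto

theorem tendsto_integral_mul (hf : TendstoL2 μ f f₀) (hk : TendstoL2 μ k k₀) :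
    Tendsto (fun n => ∫ x, f n x * k n x ∂μ) atTop (𝓝 (∫ x, f₀ x * k₀ x ∂μ)) := by
  simpa only [inner_toLp_toLp] using hf.tendsto_toLp.inner (𝕜 := ℝ) hk.tendsto_toLp

theorem tendsto_integral_sq (hf : TendstoL2 μ f f₀) :
    Tendsto (fun n => ∫ x, f n x ^ 2 ∂μ) atTop (𝓝 (∫ x, f₀ x ^ 2 ∂μ)) := by
  simpa only [sq] using hf.tendsto_integral_mul hf

end TendstoL2

end L2

/-- The derivative `∂ᵥw` of a test function of class `Cⁿ`, `1 ≤ n`, in the direction `v`, as a test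
function of class `C⁰` (it is `0` for `n = 0`). -/
noncomputable def testDeriv {E : Type*} [NormedAddCommGroup E] [NormedSpace ℝ E] {Ω : Opens E}
    {n : ℕ∞} (v : E) (w : 𝓓^{n}(Ω, ℝ)) : 𝓓^{0}(Ω, ℝ) :=
  TestFunction.lineDerivCLM ℝ v w

local notation "∂[" v "]" => testDeriv v
local notation "𝐞" j:max => EuclideanSpace.single j (1 : ℝ)

section TestFunctions

variable {E : Type*} [NormedAddCommGroup E] [NormedSpace ℝ E] {Ω : Opens E} {n : ℕ∞}

theorem coe_testDeriv (hn : 1 ≤ n) (v : E) (w : 𝓓^{n}(Ω, ℝ)) :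
    ⇑(∂[v] w) = fun x => fderiv ℝ w x v := by
  have hn' : (n : ℕ∞ω) ≠ 0 := mod_cast (one_pos.trans_le hn).ne'
  ext x
  rw [testDeriv, TestFunction.lineDerivCLM_apply_of_le (by simpa using hn)]
  exact (w.contDiff.differentiable hn' x).lineDeriv_eq_fderiv

theorem coe_lineDerivOp (v : E) (w : 𝓓(Ω, ℝ)) : ⇑(∂_{v} w : 𝓓(Ω, ℝ)) = ∂[v] w := rfl

variable [MeasurableSpace E] {μ : Measure E}

theorem setIntegral_mul_testFunction (f : E → ℝ) (w : 𝓓^{n}(Ω, ℝ)) :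
    ∫ x in Ω, f x * w x ∂μ = ∫ x, f x * w x ∂μ :=
  setIntegral_eq_integral_of_forall_compl_eq_zero fun x hx => by
    rw [image_eq_zero_of_notMem_tsupport fun hx' => hx (w.tsupport_subset hx'), mul_zero]

variable [BorelSpace E]

theorem memLp_testFunction [IsFiniteMeasureOnCompacts μ] (w : 𝓓^{n}(Ω, ℝ)) (p : ℝ≥0∞) :
    MemLp w p μ :=
  w.continuous.memLp_of_hasCompactSupport w.hasCompactSupport

theorem integrable_mul_testFunction {a : E → ℝ} (ha : LocallyIntegrableOn a Ω μ) (w : 𝓓^{n}(Ω, ℝ)) :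
    Integrable (fun x => a x * w x) μ := by
  simpa only [mul_apply', mul_comm] using w.integrable_bilin (mul ℝ ℝ) ha

variable [FiniteDimensional ℝ E] [μ.IsAddHaarMeasure]

theorem setIntegral_mul_testDeriv (hn : 1 ≤ n) {u : E → ℝ} (hu : ContDiffOn ℝ 1 u Ω)
    (w : 𝓓^{n}(Ω, ℝ)) (v : E) :
    ∫ x in Ω, u x * ∂[v] w x ∂μ = -∫ x in Ω, fderiv ℝ u x v * w x ∂μ := by
  have hu₀ : LocallyIntegrableOn u Ω μ :=
    hu.continuousOn.locallyIntegrableOn Ω.isOpen.measurableSet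
  have hu₁ : LocallyIntegrableOn (fun x => fderiv ℝ u x v) Ω μ :=
    ((hu.continuousOn_fderiv_of_isOpen Ω.isOpen le_rfl).clm_apply
      continuousOn_const).locallyIntegrableOn Ω.isOpen.measurableSet
  have hint := integrable_mul_testFunction hu₀ (∂[v] w)
  rw [setIntegral_mul_testFunction, setIntegral_mul_testFunction]
  rw [coe_testDeriv hn] at hint ⊢
  refine integral_mul_fderiv_eq_neg_fderiv_mul_of_integrable (integrable_mul_testFunction hu₁ w)
    hint (integrable_mul_testFunction hu₀ w) (fun x hx => ?_) fun x _ => ?_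
  · exact (hu.differentiableOn one_ne_zero).differentiableAt
      (Ω.isOpen.mem_nhds (w.tsupport_subset hx))
  · exact (w.contDiff.of_le (mod_cast hn)).differentiable one_ne_zero x

theorem setIntegral_testFunction_sq_eq (hn : 1 ≤ n) {ℓ : E →L[ℝ] ℝ} {v : E} (hℓ : ℓ v = 1)
    (w : 𝓓^{n}(Ω, ℝ)) :
    ∫ x in Ω, w x ^ 2 ∂μ = -2 * ∫ x in Ω, ℓ x * w x * ∂[v] w x ∂μ := by
  have hw : ContDiff ℝ 1 w := w.contDiff.of_le (mod_cast hn)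
  have hderiv (x : E) : fderiv ℝ (fun y => ℓ y * w y) x v = ℓ x * ∂[v] w x + w x := by
    rw [fderiv_fun_mul ℓ.differentiableAt (hw.differentiable one_ne_zero x), coe_testDeriv hn]
    simp [hℓ]
  have hparts := setIntegral_mul_testDeriv hn (μ := μ) (ℓ.contDiff.mul hw).contDiffOn w v
  have hint : Integrable (fun x => ℓ x * w x * ∂[v] w x) (μ.restrict Ω) :=
    (integrable_mul_testFunction
      ((ℓ.continuous.mul w.continuous).locallyIntegrable.locallyIntegrableOn Ω) _).restrict
  have hint' : Integrable (fun x => w x ^ 2) (μ.restrict Ω) :=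
    (memLp_testFunction w 2).integrable_sq
  simp_rw [hderiv, add_mul, mul_right_comm _ _ (w _), ← sq] at hparts
  rw [integral_add hint hint'] at hparts
  linarith

/-- **Poincaré's inequality** in a slab. -/
theorem setIntegral_testFunction_sq_le (hn : 1 ≤ n) {ℓ : E →L[ℝ] ℝ} {v : E} (hℓ : ℓ v = 1) {R : ℝ}
    (hR : ∀ x ∈ Ω, |ℓ x| ≤ R) (w : 𝓓^{n}(Ω, ℝ)) :
    ∫ x in Ω, w x ^ 2 ∂μ ≤ 4 * R ^ 2 * ∫ x in Ω, ∂[v] w x ^ 2 ∂μ := by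
  have hint : Integrable (fun x => ℓ x * w x * ∂[v] w x) (μ.restrict Ω) :=
    (integrable_mul_testFunction
      ((ℓ.continuous.mul w.continuous).locallyIntegrable.locallyIntegrableOn Ω) _).restrict
  have hw : Integrable (fun x => w x ^ 2) (μ.restrict Ω) := (memLp_testFunction w 2).integrable_sq
  have hw' : Integrable (fun x => ∂[v] w x ^ 2) (μ.restrict Ω) :=
    (memLp_testFunction _ 2).integrable_sq
  have hle : ∫ x in Ω, -2 * (ℓ x * w x * ∂[v] w x) ∂μ
      ≤ ∫ x in Ω, ((1 / 2) * w x ^ 2 + 2 * R ^ 2 * ∂[v] w x ^ 2) ∂μ := by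
    refine setIntegral_mono_on (hint.const_mul _) ((hw.const_mul _).add (hw'.const_mul _))
      Ω.isOpen.measurableSet fun x hx => ?_
    have hsq : ℓ x ^ 2 * ∂[v] w x ^ 2 ≤ R ^ 2 * ∂[v] w x ^ 2 := by
      gcongr ?_ * _
      exact sq_le_sq.2 ((hR x hx).trans (le_abs_self R))
    nlinarith [sq_nonneg (w x + 2 * ℓ x * ∂[v] w x)]
  rw [integral_const_mul, ← setIntegral_testFunction_sq_eq hn hℓ,
    integral_add (hw.const_mul _) (hw'.const_mul _), integral_const_mul, integral_const_mul] at hle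
  linarith

end TestFunctions

section WeakDerivatives

variable {d : ℕ} {Ω : Opens (EuclideanSpace ℝ (Fin d))} {j : Fin d}
  {u u' g g' : EuclideanSpace ℝ (Fin d) → ℝ}

theorem hasWeakPartialDeriv_iff : HasWeakPartialDeriv Ω j u g ↔
    ∀ w : 𝓓(Ω, ℝ), ∫ x in Ω, u x * ∂[𝐞 j] w x = -∫ x in Ω, g x * w x := by
  simp only [HasWeakPartialDeriv, coe_testDeriv le_top]

theorem hasWeakPartialDeriv_fderiv (hu : ContDiffOn ℝ 1 u Ω) (j : Fin d) :
    HasWeakPartialDeriv Ω j u fun x => fderiv ℝ u x (𝐞 j) :=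
  hasWeakPartialDeriv_iff.2 fun w => setIntegral_mul_testDeriv le_top hu w _

namespace HasWeakPartialDeriv

theorem sub (h : HasWeakPartialDeriv Ω j u g) (h' : HasWeakPartialDeriv Ω j u' g')
    (hu : LocallyIntegrableOn u Ω) (hu' : LocallyIntegrableOn u' Ω)
    (hg : LocallyIntegrableOn g Ω) (hg' : LocallyIntegrableOn g' Ω) :
    HasWeakPartialDeriv Ω j (fun x => u x - u' x) (fun x => g x - g' x) := by
  rw [hasWeakPartialDeriv_iff] at h h' ⊢
  intro w
  simp_rw [sub_mul]
  rw [integral_sub (integrable_mul_testFunction hu _).restrict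
      (integrable_mul_testFunction hu' _).restrict,
    integral_sub (integrable_mul_testFunction hg w).restrict
      (integrable_mul_testFunction hg' w).restrict, h, h']
  ring

theorem ae_eq (h : HasWeakPartialDeriv Ω j u g) (h' : HasWeakPartialDeriv Ω j u g')
    (hg : LocallyIntegrableOn g Ω) (hg' : LocallyIntegrableOn g' Ω) :
    g =ᵐ[volume.restrict Ω] g' := by
  rw [EventuallyEq, ae_restrict_iff' Ω.isOpen.measurableSet]
  refine (Ω.isOpen.ae_eq_zero_of_integral_contDiff_smul_eq_zero (hg.sub hg')
    fun w hw hwc hwΩ => ?_).mono fun x hx hxΩ => sub_eq_zero.1 (hx hxΩ)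
  let W : 𝓓(Ω, ℝ) := ⟨w, hw, hwc, hwΩ⟩
  have hgW : ∫ x, g x * W x = ∫ x, g' x * W x := by
    rw [← setIntegral_mul_testFunction g, ← setIntegral_mul_testFunction g']
    exact neg_injective ((h W).symm.trans (h' W))
  calc ∫ x, w x • (g x - g' x) = ∫ x, (g x * W x - g' x * W x) := by
        refine integral_congr_ae (.of_forall fun x => ?_)
        simp only [W, TestFunction.coe_mk, smul_eq_mul]
        ring
    _ = 0 := by
        rw [integral_sub (integrable_mul_testFunction hg W) (integrable_mul_testFunction hg' W),
          hgW, sub_self]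

theorem of_tendstoL2 {f k : ℕ → EuclideanSpace ℝ (Fin d) → ℝ}
    (h : ∀ n, HasWeakPartialDeriv Ω j (f n) (k n)) (hf : TendstoL2 (volume.restrict Ω) f u)
    (hk : TendstoL2 (volume.restrict Ω) k g) : HasWeakPartialDeriv Ω j u g := by
  simp only [hasWeakPartialDeriv_iff] at h ⊢
  intro w
  have htest {n : ℕ∞} (w : 𝓓^{n}(Ω, ℝ)) :=
    tendstoL2_const (memLp_testFunction (μ := volume.restrict Ω) w 2)
  exact tendsto_nhds_unique (hf.tendsto_integral_mul (htest _))
    ((hk.tendsto_integral_mul (htest w)).neg.congr fun n => (h n w).symm)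

end HasWeakPartialDeriv

namespace HasH1Gradient

variable {g g' : Fin d → EuclideanSpace ℝ (Fin d) → ℝ}

theorem congr_ae (h : HasH1Gradient Ω u g) (he : u =ᵐ[volume.restrict Ω] u') :
    HasH1Gradient Ω u' g where
  memLp := (memLp_congr_ae he).1 h.memLp
  memLp_grad := h.memLp_grad
  weak j w := by
    rw [← h.weak j w]
    exact integral_congr_ae (he.symm.mul (ae_eq_refl _))

theorem locallyIntegrableOn (h : HasH1Gradient Ω u g) : LocallyIntegrableOn u Ω :=
  locallyIntegrableOn_of_locallyIntegrable_restrict (h.memLp.locallyIntegrable one_le_two)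

theorem locallyIntegrableOn_grad (h : HasH1Gradient Ω u g) (j : Fin d) :
    LocallyIntegrableOn (g j) Ω :=
  locallyIntegrableOn_of_locallyIntegrable_restrict ((h.memLp_grad j).locallyIntegrable one_le_two)

theorem sub (h : HasH1Gradient Ω u g) (h' : HasH1Gradient Ω u' g') :
    HasH1Gradient Ω (fun x => u x - u' x) (fun j x => g j x - g' j x) where
  memLp := h.memLp.sub h'.memLp
  memLp_grad j := (h.memLp_grad j).sub (h'.memLp_grad j)
  weak j := (h.weak j).sub (h'.weak j) h.locallyIntegrableOn h'.locallyIntegrableOn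
    (h.locallyIntegrableOn_grad j) (h'.locallyIntegrableOn_grad j)

theorem ae_eq_fderiv (h : HasH1Gradient Ω u g) (hu : ContDiffOn ℝ 1 u Ω) (j : Fin d) :
    g j =ᵐ[volume.restrict Ω] fun x => fderiv ℝ u x (𝐞 j) :=
  (h.weak j).ae_eq (hasWeakPartialDeriv_fderiv hu j) (h.locallyIntegrableOn_grad j)
    (((hu.continuousOn_fderiv_of_isOpen Ω.isOpen le_rfl).clm_apply
      continuousOn_const).locallyIntegrableOn Ω.isOpen.measurableSet)

end HasH1Gradient

theorem isFiniteMeasure_restrict_of_isBounded {X : Type*} [PseudoMetricSpace X] [ProperSpace X]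
    [MeasurableSpace X] {μ : Measure X} [IsFiniteMeasureOnCompacts μ] {s : Set X}
    (hs : Bornology.IsBounded s) : IsFiniteMeasure (μ.restrict s) :=
  isFiniteMeasure_restrict.2 hs.measure_lt_top.ne

theorem hasH1Gradient_lineDeriv_of_lipschitzWith {C : ℝ≥0} (hu : LipschitzWith C u)
    (hbdd : Bornology.IsBounded (Ω : Set (EuclideanSpace ℝ (Fin d)))) :
    HasH1Gradient Ω u fun j x => lineDeriv ℝ u x (𝐞 j) where
  memLp := by
    have := isFiniteMeasure_restrict_of_isBounded (μ := volume) hbdd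
    obtain ⟨R, hR⟩ := (hu.isBounded_image hbdd).exists_norm_le
    refine MemLp.of_bound hu.continuous.aestronglyMeasurable R ?_
    filter_upwards [ae_restrict_mem Ω.isOpen.measurableSet] with x hx
    exact hR _ (mem_image_of_mem u hx)
  memLp_grad j := by
    have := isFiniteMeasure_restrict_of_isBounded (μ := volume) hbdd
    exact ((hu.memLp_lineDeriv (μ := volume) (𝐞 j)).restrict _).mono_exponent le_top
  weak j := hasWeakPartialDeriv_iff.2 fun w => by
    obtain ⟨D, hD⟩ := (w.contDiff.of_le (mod_cast le_top)).lipschitzWith_of_hasCompactSupport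
      w.hasCompactSupport one_ne_zero
    have hderiv (x : EuclideanSpace ℝ (Fin d)) :
        lineDeriv ℝ w x (-𝐞 j) * u x = -(u x * ∂[𝐞 j] w x) := by
      rw [(w.contDiff.differentiable (by simp) x).lineDeriv_eq_fderiv, map_neg,
        coe_testDeriv le_top]
      ring
    have hparts := hu.integral_lineDeriv_mul_eq (μ := volume) hD w.hasCompactSupport (𝐞 j)
    simp_rw [hderiv, integral_neg] at hparts
    rw [setIntegral_mul_testFunction, setIntegral_mul_testFunction, hparts, neg_neg]

end WeakDerivatives

section ZeroTrace

variable {d : ℕ} {Ω : Opens (EuclideanSpace ℝ (Fin d))} {w w' : ℕ → 𝓓(Ω, ℝ)}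
  {u v v' : EuclideanSpace ℝ (Fin d) → ℝ} {g g' : Fin d → EuclideanSpace ℝ (Fin d) → ℝ}

/-- Convergence of a sequence of test functions to `v` in `H¹(Ω)`, where `g` is the weak gradient of
`v`. -/
structure TendstoH1 (w : ℕ → 𝓓(Ω, ℝ)) (v : EuclideanSpace ℝ (Fin d) → ℝ)
    (g : Fin d → EuclideanSpace ℝ (Fin d) → ℝ) : Prop where
  tendstoL2 : TendstoL2 (volume.restrict Ω) (fun n => w n) v
  tendstoL2_grad : ∀ j, TendstoL2 (volume.restrict Ω) (fun n => ∂[𝐞 j] (w n)) (g j)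

namespace TendstoH1

theorem hasH1Gradient (h : TendstoH1 w v g) : HasH1Gradient Ω v g where
  memLp := h.tendstoL2.memLp_lim
  memLp_grad j := (h.tendstoL2_grad j).memLp_lim
  weak j := by
    refine .of_tendstoL2 (fun n => ?_) h.tendstoL2 (h.tendstoL2_grad j)
    rw [coe_testDeriv le_top]
    exact hasWeakPartialDeriv_fderiv ((w n).contDiff.of_le (mod_cast le_top)).contDiffOn j

theorem congr_ae (h : TendstoH1 w v g) (hv : v =ᵐ[volume.restrict Ω] v') : TendstoH1 w v' g :=
  ⟨h.tendstoL2.congr_lim_ae hv, h.tendstoL2_grad⟩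

theorem sub (h : TendstoH1 w v g) (h' : TendstoH1 w' v' g') :
    TendstoH1 (fun n => w n - w' n) (fun x => v x - v' x) (fun j x => g j x - g' j x) where
  tendstoL2 := h.tendstoL2.sub h'.tendstoL2
  tendstoL2_grad j := by
    have hsub (n : ℕ) : ∂[𝐞 j] (w n - w' n) = ∂[𝐞 j] (w n) - ∂[𝐞 j] (w' n) :=
      map_sub (TestFunction.lineDerivCLM ℝ (𝐞 j)) (w n) (w' n)
    simp only [hsub]
    exact (h.tendstoL2_grad j).sub (h'.tendstoL2_grad j)

end TendstoH1

theorem tendstoH1_const (w : 𝓓(Ω, ℝ)) : TendstoH1 (fun _ => w) w fun j => ∂[𝐞 j] w :=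
  ⟨tendstoL2_const (memLp_testFunction w 2), fun _ => tendstoL2_const (memLp_testFunction _ 2)⟩

theorem memH10_iff : MemH10 Ω v ↔ ∃ g, ∃ w : ℕ → 𝓓(Ω, ℝ), TendstoH1 w v g := by
  refine ⟨fun ⟨g, hg, w, hw, hw'⟩ => ⟨g, w, ⟨fun n => memLp_testFunction _ 2, hg.memLp, hw⟩,
    fun j => ⟨fun n => memLp_testFunction _ 2, hg.memLp_grad j, ?_⟩⟩,
    fun ⟨g, w, h⟩ => ⟨g, h.hasH1Gradient, w, h.tendstoL2.tendsto, fun j => ?_⟩⟩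
  · simpa only [coe_testDeriv le_top] using hw' j
  · simpa only [coe_testDeriv le_top] using (h.tendstoL2_grad j).tendsto

theorem MemH10.sub (hv : MemH10 Ω v) (hv' : MemH10 Ω v') : MemH10 Ω fun x => v x - v' x := by
  obtain ⟨g, w, hw⟩ := memH10_iff.1 hv
  obtain ⟨g', w', hw'⟩ := memH10_iff.1 hv'
  exact memH10_iff.2 ⟨_, fun n => w n - w' n, hw.sub hw'⟩

/-- A test function as an element of `L²(Ω)`. -/
noncomputable def toL2 {n : ℕ∞} :
    𝓓^{n}(Ω, ℝ) →ₗ[ℝ] Lp ℝ 2 (volume.restrict (Ω : Set (EuclideanSpace ℝ (Fin d)))) where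
  toFun w := (memLp_testFunction w 2).toLp w
  map_add' w w' := by rw [← MemLp.toLp_add]; rfl
  map_smul' c w := by rw [RingHom.id_apply, ← MemLp.toLp_const_smul]; rfl

/-- The gradient of a test function as an element of `L²(Ω)ᵈ`. -/
noncomputable def gradToL2 :
    𝓓(Ω, ℝ) →ₗ[ℝ] PiLp 2
      fun _ : Fin d => Lp ℝ 2 (volume.restrict (Ω : Set (EuclideanSpace ℝ (Fin d)))) :=
  (WithLp.linearEquiv 2 ℝ _).symm.toLinearMap ∘ₗ
    LinearMap.pi fun j => toL2 ∘ₗ (TestFunction.lineDerivCLM (k := 0) ℝ (𝐞 j)).toLinearMap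

theorem gradToL2_apply (w : 𝓓(Ω, ℝ)) (j : Fin d) : gradToL2 w j = toL2 (∂[𝐞 j] w) := rfl

theorem norm_toL2_sq {n : ℕ∞} (w : 𝓓^{n}(Ω, ℝ)) : ‖toL2 w‖ ^ 2 = ∫ x in Ω, w x ^ 2 := by
  have hw := memLp_testFunction (μ := volume.restrict Ω) w 2
  simp_rw [← real_inner_self_eq_norm_sq, sq]
  exact inner_toLp_toLp hw hw

theorem norm_toL2_le (j : Fin d) {R : ℝ} (hR0 : 0 ≤ R) (hR : ∀ x ∈ Ω, |x j| ≤ R) (w : 𝓓(Ω, ℝ)) :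
    ‖toL2 w‖ ≤ 2 * R * ‖gradToL2 w‖ := by
  have hpoincare : ‖toL2 w‖ ^ 2 ≤ (2 * R * ‖gradToL2 w j‖) ^ 2 := by
    rw [mul_pow, mul_pow, gradToL2_apply, norm_toL2_sq, norm_toL2_sq]
    norm_num only
    exact setIntegral_testFunction_sq_le le_top (ℓ := EuclideanSpace.proj j) (by simp) hR w
  calc ‖toL2 w‖ ≤ 2 * R * ‖gradToL2 w j‖ :=
        (sq_le_sq₀ (norm_nonneg _) (by positivity)).1 hpoincare
    _ ≤ 2 * R * ‖gradToL2 w‖ := by gcongr; exact PiLp.norm_apply_le _ j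

theorem exists_forall_abs_apply_le (j : Fin d)
    (hbdd : Bornology.IsBounded (Ω : Set (EuclideanSpace ℝ (Fin d)))) :
    ∃ R : ℝ, 0 ≤ R ∧ ∀ x ∈ Ω, |x j| ≤ R := by
  obtain ⟨R, hR0, hR⟩ := hbdd.exists_pos_norm_le
  exact ⟨R, hR0.le, fun x hx => (PiLp.norm_apply_le x j).trans (hR x hx)⟩

theorem exists_tendstoH1_of_tendsto_gradToL2 (hd : 0 < d)
    (hbdd : Bornology.IsBounded (Ω : Set (EuclideanSpace ℝ (Fin d)))) {P}
    (hP : Tendsto (fun n => gradToL2 (w n)) atTop (𝓝 P)) :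
    ∃ v, TendstoH1 w v fun j => P j := by
  obtain ⟨R, hR0, hR⟩ := exists_forall_abs_apply_le ⟨0, hd⟩ hbdd
  have hcauchy : CauchySeq fun n => toL2 (w n) := by
    rw [cauchySeq_iff_tendsto_dist_atTop_0]
    refine squeeze_zero (fun _ => dist_nonneg) (fun n => ?_)
      (by simpa using (cauchySeq_iff_tendsto_dist_atTop_0.1 hP.cauchySeq).const_mul (2 * R))
    rw [dist_eq_norm, dist_eq_norm, ← map_sub, ← map_sub]
    exact norm_toL2_le ⟨0, hd⟩ hR0 hR _
  obtain ⟨v, hv⟩ := cauchySeq_tendsto_of_complete hcauchy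
  exact ⟨v, tendstoL2_of_tendsto_toLp (fun n => memLp_testFunction _ 2) hv, fun j =>
    tendstoL2_of_tendsto_toLp (fun n => memLp_testFunction _ 2)
      (((PiLp.continuous_apply 2 _ j).tendsto P).comp hP)⟩

/-- The projection of a vector field in `L²(Ω)ᵈ` onto the gradients of functions in `H¹₀(Ω)`. -/
theorem exists_tendstoH1_forall_sum_eq_zero (hd : 0 < d)
    (hbdd : Bornology.IsBounded (Ω : Set (EuclideanSpace ℝ (Fin d))))
    (hg : ∀ j, MemLp (g j) 2 (volume.restrict Ω)) :
    ∃ v p, (∃ w : ℕ → 𝓓(Ω, ℝ), TendstoH1 w v p) ∧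
      ∀ w : 𝓓(Ω, ℝ), ∑ j, ∫ x in Ω, (g j x - p j x) * ∂[𝐞 j] w x = 0 := by
  set K := (LinearMap.range (gradToL2 (Ω := Ω))).topologicalClosure
  have : CompleteSpace K := (Submodule.isClosed_topologicalClosure _).completeSpace_coe
  set G : PiLp 2 fun _ : Fin d => Lp ℝ 2 (volume.restrict (Ω : Set (EuclideanSpace ℝ (Fin d)))) :=
    WithLp.toLp 2 fun j => (hg j).toLp (g j)
  set P := K.starProjection G
  obtain ⟨y, hy, hlim⟩ := mem_closure_iff_seq_limit.1 (K.starProjection_apply_mem G)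
  choose w hw using hy
  obtain ⟨v, hv⟩ := exists_tendstoH1_of_tendsto_gradToL2 (w := w) (P := P) hd hbdd
    (by simpa only [hw] using hlim)
  refine ⟨v, _, ⟨w, hv⟩, fun w => ?_⟩
  have horth : inner ℝ (G - P) (gradToL2 w) = 0 :=
    K.starProjection_inner_eq_zero G _ (subset_closure (LinearMap.mem_range_self gradToL2 w))
  rw [PiLp.inner_apply] at horth
  refine (Finset.sum_congr rfl fun j _ => ?_).trans horth
  have hinner := inner_toLp_toLp ((hg j).sub (Lp.memLp (P j)))
    (memLp_testFunction (μ := volume.restrict Ω) (∂[𝐞 j] w) 2)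
  rw [MemLp.toLp_sub (hg j) (Lp.memLp (P j)), Lp.toLp_coeFn] at hinner
  exact hinner.symm

end ZeroTrace

section Existence

variable {d : ℕ} {Ω : Opens (EuclideanSpace ℝ (Fin d))} {u : EuclideanSpace ℝ (Fin d) → ℝ}
  {g : Fin d → EuclideanSpace ℝ (Fin d) → ℝ}

theorem laplacian_testFunction_eq_sum (w : 𝓓(Ω, ℝ)) (x : EuclideanSpace ℝ (Fin d)) :
    Δ (w : EuclideanSpace ℝ (Fin d) → ℝ) x = ∑ j, ∂[𝐞 j] (∂_{𝐞 j} w : 𝓓(Ω, ℝ)) x := by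
  rw [laplacian_eq_sum_fderiv (EuclideanSpace.basisFun (Fin d) ℝ)
    (contDiff_infty.1 w.contDiff 2).contDiffAt]
  simp only [coe_testDeriv le_top, coe_lineDerivOp, EuclideanSpace.basisFun_apply]

theorem HasH1Gradient.isWeaklyHarmonicOn (h : HasH1Gradient Ω u g)
    (hg : ∀ w : 𝓓(Ω, ℝ), ∑ j, ∫ x in Ω, g j x * ∂[𝐞 j] w x = 0) :
    IsWeaklyHarmonicOn ((Ω : Set (EuclideanSpace ℝ (Fin d))).indicator u) Ω := by
  intro w
  have hint (j : Fin d) :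
      Integrable (fun x => u x * ∂[𝐞 j] (∂_{𝐞 j} w : 𝓓(Ω, ℝ)) x) (volume.restrict Ω) :=
    h.memLp.integrable_mul (memLp_testFunction _ 2)
  calc ∫ x, (Ω : Set (EuclideanSpace ℝ (Fin d))).indicator u x
        * Δ (w : EuclideanSpace ℝ (Fin d) → ℝ) x
      = ∫ x in Ω, u x * Δ (w : EuclideanSpace ℝ (Fin d) → ℝ) x := by
        simp_rw [← integral_indicator Ω.isOpen.measurableSet, indicator_mul_left]
    _ = ∑ j, ∫ x in Ω, u x * ∂[𝐞 j] (∂_{𝐞 j} w : 𝓓(Ω, ℝ)) x := by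
        simp_rw [laplacian_testFunction_eq_sum, Finset.mul_sum]
        exact integral_finsetSum _ fun j _ => hint j
    _ = -∑ j, ∫ x in Ω, g j x * ∂[𝐞 j] w x := by
        simp_rw [hasWeakPartialDeriv_iff.1 (h.weak _), Finset.sum_neg_distrib,
          coe_lineDerivOp]
    _ = 0 := by rw [hg, neg_zero]

theorem HasH1Gradient.exists_harmonicOnNhd_ae_eq (h : HasH1Gradient Ω u g)
    (hbdd : Bornology.IsBounded (Ω : Set (EuclideanSpace ℝ (Fin d))))
    (hg : ∀ w : 𝓓(Ω, ℝ), ∑ j, ∫ x in Ω, g j x * ∂[𝐞 j] w x = 0) :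
    ∃ u', InnerProductSpace.HarmonicOnNhd u' Ω ∧ u' =ᵐ[volume.restrict Ω] u := by
  have := isFiniteMeasure_restrict_of_isBounded (μ := volume) hbdd
  have hmeas := Ω.isOpen.measurableSet
  have hint : Integrable ((Ω : Set (EuclideanSpace ℝ (Fin d))).indicator u) :=
    (integrable_indicator_iff hmeas).2 (h.memLp.integrable one_le_two)
  obtain ⟨u', hu', hae⟩ :=
    (h.isWeaklyHarmonicOn hg).exists_harmonicOnNhd_ae_eq hint.locallyIntegrable
  exact ⟨u', hu', hae.trans (indicator_ae_eq_restrict hmeas)⟩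

theorem exists_lipschitzWith_extension {X : Type*} [PseudoMetricSpace X] {s : Set X} {φ : s → ℝ}
    {K : ℝ≥0} (hφ : LipschitzWith K φ) :
    ∃ f : X → ℝ, LipschitzWith K f ∧ ∀ z : s, f z = φ z := by
  classical
  obtain ⟨f, hf, hfφ⟩ := LipschitzOnWith.extend_real (K := K) (s := s)
    (f := fun x => if h : x ∈ s then φ ⟨x, h⟩ else 0) (fun x hx y hy => by
      simpa [hx, hy] using hφ ⟨x, hx⟩ ⟨y, hy⟩)
  exact ⟨f, hf, fun z => by simp [← hfφ z.2]⟩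

/-- **Dirichlet's principle**. -/
theorem exists_isVariationalSolution (hd : 0 < d)
    (hbdd : Bornology.IsBounded (Ω : Set (EuclideanSpace ℝ (Fin d))))
    {φ : C(frontier (Ω : Set (EuclideanSpace ℝ (Fin d))), ℝ)} {K : ℝ≥0}
    (hφ : LipschitzWith K φ) :
    ∃ u g, IsVariationalSolution Ω φ u ∧ HasH1Gradient Ω u g := by
  obtain ⟨Φ, hΦ, hΦφ⟩ := exists_lipschitzWith_extension hφ
  have hΦH1 := hasH1Gradient_lineDeriv_of_lipschitzWith (Ω := Ω) hΦ hbdd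
  obtain ⟨v, p, ⟨w, hw⟩, horth⟩ :=
    exists_tendstoH1_forall_sum_eq_zero hd hbdd hΦH1.memLp_grad
  have hsub := hΦH1.sub hw.hasH1Gradient
  obtain ⟨u, hu, huv⟩ := hsub.exists_harmonicOnNhd_ae_eq hbdd horth
  have hv : v =ᵐ[volume.restrict Ω] fun x => Φ x - u x := by
    filter_upwards [huv] with x hx
    rw [hx, sub_sub_cancel]
  exact ⟨u, _, ⟨hu, Φ, hΦ.continuous.continuousOn, hΦφ, memH10_iff.2 ⟨p, w, hw.congr_ae hv⟩⟩,
    hsub.congr_ae huv.symm⟩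

theorem enorm_gradient_sq (u : EuclideanSpace ℝ (Fin d) → ℝ) (x : EuclideanSpace ℝ (Fin d)) :
    ‖gradient u x‖ₑ ^ 2 = ∑ j, ‖fderiv ℝ u x (𝐞 j)‖ₑ ^ 2 := by
  have hcoord (j : Fin d) : fderiv ℝ u x (𝐞 j) = gradient u x j := by
    rw [← inner_gradient_left, EuclideanSpace.inner_single_right]
    simp
  simp_rw [hcoord, ← ofReal_norm, ← ENNReal.ofReal_pow (norm_nonneg _)]
  rw [EuclideanSpace.norm_sq_eq, ENNReal.ofReal_sum_of_nonneg fun _ _ => by positivity]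

theorem HasH1Gradient.lintegral_gradient_lt_top (h : HasH1Gradient Ω u g)
    (hu : ContDiffOn ℝ 1 u Ω) : ∫⁻ x in Ω, ‖gradient u x‖ₑ ^ 2 < ⊤ := by
  have hgrad : (fun x => ‖gradient u x‖ₑ ^ 2) =ᵐ[volume.restrict Ω]
      fun x => ∑ j, ‖g j x‖ₑ ^ 2 := by
    filter_upwards [ae_all_iff.2 fun j => h.ae_eq_fderiv hu j] with x hx
    simp_rw [enorm_gradient_sq, hx]
  rw [lintegral_congr_ae hgrad, lintegral_finsetSum' _ fun j _ =>
    (h.memLp_grad j).aestronglyMeasurable.enorm.pow_const 2]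
  refine ENNReal.sum_lt_top.2 fun j _ => ?_
  simpa using lintegral_rpow_enorm_lt_top_of_eLpNorm_lt_top two_ne_zero ENNReal.ofNat_ne_top
    (h.memLp_grad j).2

end Existence

section PositivePart

/-- `G` is a `C¹` substitute for the positive part `s ↦ max s 0`, which is not differentiable at
`0` and would not map test functions to test functions. -/
structure IsC1PosPart (G : ℝ → ℝ) : Prop where
  contDiff : ContDiff ℝ 1 G
  deriv_mem_Icc : ∀ s, deriv G s ∈ Icc 0 1
  eq_zero_iff : ∀ s, G s = 0 ↔ s ≤ 0

theorem exists_isC1PosPart : ∃ G, IsC1PosPart G := by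
  have hcont : Continuous Real.smoothTransition := Real.smoothTransition.continuous
  have hderiv (s : ℝ) : HasDerivAt (fun s => ∫ t in 0..s, Real.smoothTransition t)
      (Real.smoothTransition s) s :=
    intervalIntegral.integral_hasDerivAt_right (hcont.intervalIntegrable ..)
      hcont.aestronglyMeasurable.stronglyMeasurableAtFilter hcont.continuousAt
  refine ⟨fun s => ∫ t in 0..s, Real.smoothTransition t, ?_, fun s => ?_, fun s => ⟨?_, ?_⟩⟩
  · rw [contDiff_one_iff_deriv, funext fun s => (hderiv s).deriv]
    exact ⟨fun s => (hderiv s).differentiableAt, hcont⟩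
  · rw [(hderiv s).deriv]
    exact ⟨Real.smoothTransition.nonneg s, Real.smoothTransition.le_one s⟩
  · intro h
    by_contra! hs
    exact (intervalIntegral.intervalIntegral_pos_of_pos_on (hcont.intervalIntegrable ..)
      (fun t ht => Real.smoothTransition.pos_of_pos ht.1) hs).ne' h
  · intro hs
    refine intervalIntegral.integral_zero_ae (.of_forall fun t ht => ?_)
    rw [uIoc_of_ge hs] at ht
    exact Real.smoothTransition.zero_of_nonpos ht.2

theorem IsC1PosPart.lipschitzWith {G : ℝ → ℝ} (hG : IsC1PosPart G) : LipschitzWith 1 G :=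
  lipschitzWith_of_nnnorm_deriv_le (hG.contDiff.differentiable one_ne_zero) fun s => by
    rw [← NNReal.coe_le_coe, coe_nnnorm, Real.norm_of_nonneg (hG.deriv_mem_Icc s).1]
    exact (hG.deriv_mem_Icc s).2

theorem mul_add_add_sq_le {p : ℝ} (hp : p ∈ Icc 0 1) (a e c : ℝ) :
    (p * (a + e) + c) ^ 2 ≤ 4 * (a * (p * (a + e) + c)) + 2 * e ^ 2 + 2 * c ^ 2 - 4 * (c * a) := by
  have hsq : p ^ 2 * (a + e) ^ 2 ≤ p * (a + e) ^ 2 := by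
    gcongr
    nlinarith [hp.1, hp.2]
  linarith [sq_nonneg (p * (a + e) - c), mul_nonneg hp.1 (sq_nonneg a),
    mul_nonneg (sub_nonneg.2 hp.2) (sq_nonneg e)]

end PositivePart

section Product

variable {E : Type*} [NormedAddCommGroup E] [NormedSpace ℝ E] {Ω : Opens E} {n : ℕ∞} {a : E → ℝ}

/-- The product of a function of class `Cⁿ` on `Ω` and a test function, as a test function. -/
noncomputable def mulTestFunction (a : E → ℝ) (ha : ContDiffOn ℝ n a Ω)
    (w : 𝓓^{n}(Ω, ℝ)) : 𝓓^{n}(Ω, ℝ) where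
  toFun x := a x * w x
  contDiff' := contMDiff_iff_contDiff.1 <| contMDiff_of_tsupport fun _ hx =>
    ((ha.contDiffAt (Ω.isOpen.mem_nhds (w.tsupport_subset (tsupport_mul_subset_right hx)))).mul
      w.contDiff.contDiffAt).contMDiffAt
  hasCompactSupport' := w.hasCompactSupport.mul_left
  tsupport_subset' := tsupport_mul_subset_right.trans w.tsupport_subset

theorem mulTestFunction_apply (ha : ContDiffOn ℝ n a Ω) (w : 𝓓^{n}(Ω, ℝ)) (x : E) :
    mulTestFunction a ha w x = a x * w x := rfl

theorem testDeriv_mulTestFunction (hn : 1 ≤ n) (ha : ContDiffOn ℝ n a Ω) (w : 𝓓^{n}(Ω, ℝ)) (v : E)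
    {x : E} (hx : x ∈ Ω) :
    ∂[v] (mulTestFunction a ha w) x = fderiv ℝ a x v * w x + a x * ∂[v] w x := by
  have hn' : (n : ℕ∞ω) ≠ 0 := mod_cast (one_pos.trans_le hn).ne'
  have ha' : DifferentiableAt ℝ a x :=
    (ha.contDiffAt (Ω.isOpen.mem_nhds hx)).differentiableAt hn'
  rw [coe_testDeriv hn, coe_testDeriv hn]
  change fderiv ℝ (fun y => a y * w y) x v = _
  rw [fderiv_fun_mul ha' (w.contDiff.differentiable hn' x)]
  simp only [add_apply, FunLike.coe_smul, Pi.smul_apply, smul_eq_mul]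
  ring

theorem exists_testFunction_eventually_eq_one [FiniteDimensional ℝ E] {K : Set E}
    (hK : IsCompact K) (hKΩ : K ⊆ Ω) :
    ∃ η : 𝓓^{n}(Ω, ℝ), (∀ x ∈ K, ∀ᶠ y in 𝓝 x, η y = 1) ∧ ∀ x, η x ∈ Icc (0 : ℝ) 1 := by
  obtain ⟨L, hL, hKL, hLΩ⟩ := exists_compact_between hK Ω.isOpen hKΩ
  obtain ⟨f, hf1, hf0, hf⟩ := exists_contMDiffMap_one_nhds_of_subset_interior
    (modelWithCornersSelf ℝ E) (n := n) hK.isClosed hKL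
  have hsupp : tsupport f ⊆ L :=
    closure_minimal (fun x hx => by_contra fun hxL => hx (hf0 x hxL)) hL.isClosed
  exact ⟨⟨f, f.contMDiff.contDiff, hL.of_isClosed_subset (isClosed_tsupport _) hsupp,
    hsupp.trans hLΩ⟩, fun x hx => eventually_nhdsSet_iff_forall.1 hf1 x hx, hf⟩

end Product

section MaximumPrinciple

variable {d : ℕ} {Ω : Opens (EuclideanSpace ℝ (Fin d))} {u : EuclideanSpace ℝ (Fin d) → ℝ}

theorem sum_setIntegral_fderiv_mul_testDeriv_eq_zero
    (hu : InnerProductSpace.HarmonicOnNhd u Ω) {n : ℕ∞} (hn : 1 ≤ n) (w : 𝓓^{n}(Ω, ℝ)) :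
    ∑ j, ∫ x in Ω, fderiv ℝ u x (𝐞 j) * ∂[𝐞 j] w x = 0 := by
  have hu₁ (j : Fin d) : ContDiffOn ℝ 1 (fun x => fderiv ℝ u x (𝐞 j)) Ω :=
    (hu.contDiffOn.fderiv_of_isOpen Ω.isOpen (by norm_num)).clm_apply contDiffOn_const
  have hint (j : Fin d) : Integrable
      (fun x => fderiv ℝ (fun y => fderiv ℝ u y (𝐞 j)) x (𝐞 j) * w x) (volume.restrict Ω) :=
    (integrable_mul_testFunction ((((hu₁ j).continuousOn_fderiv_of_isOpen Ω.isOpen le_rfl).clm_apply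
      continuousOn_const).locallyIntegrableOn Ω.isOpen.measurableSet) w).restrict
  simp_rw [setIntegral_mul_testDeriv hn (hu₁ _), Finset.sum_neg_distrib]
  rw [← integral_finsetSum _ fun j _ => hint j, neg_eq_zero]
  refine setIntegral_eq_zero_of_forall_eq_zero fun x hx => ?_
  obtain ⟨hu₂, hΔ⟩ := hu x hx
  have hsum := laplacian_eq_sum_fderiv (EuclideanSpace.basisFun (Fin d) ℝ) hu₂
  simp only [EuclideanSpace.basisFun_apply] at hsum
  rw [← Finset.sum_mul, ← hsum, hΔ.self_of_nhds, Pi.zero_apply, zero_mul]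

/-- The truncation `G(u + w) η` of `u + w` for test functions `w` and `η`. The estimates below keep
`η` fixed while `w` varies, so that only `w` has to be approximated in the energy norm. -/
noncomputable def truncation {G : ℝ → ℝ} (hG : ContDiff ℝ 1 G) (hu : ContDiffOn ℝ 1 u Ω)
    (η : 𝓓^{1}(Ω, ℝ)) (w : 𝓓(Ω, ℝ)) : 𝓓^{1}(Ω, ℝ) :=
  mulTestFunction (fun x => G (u x + w x))
    (hG.comp_contDiffOn (hu.add (w.contDiff.of_le (mod_cast le_top)).contDiffOn)) η

section Truncation

variable {G : ℝ → ℝ} (hG : ContDiff ℝ 1 G) {η : 𝓓^{1}(Ω, ℝ)} (w : 𝓓(Ω, ℝ))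

theorem testDeriv_truncation (hu : ContDiffOn ℝ 1 u Ω) (v : EuclideanSpace ℝ (Fin d))
    {x : EuclideanSpace ℝ (Fin d)} (hx : x ∈ Ω) :
    ∂[v] (truncation hG hu η w) x =
      deriv G (u x + w x) * η x * (fderiv ℝ u x v + ∂[v] w x) + G (u x + w x) * ∂[v] η x := by
  have hu' : DifferentiableAt ℝ u x :=
    (hu.contDiffAt (Ω.isOpen.mem_nhds hx)).differentiableAt one_ne_zero
  have hw' : DifferentiableAt ℝ w x := w.contDiff.differentiable (by simp) x
  have hG' := (hG.differentiable one_ne_zero (u x + w x)).hasDerivAt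
  have hq := (hG'.comp_hasFDerivAt x (hu'.hasFDerivAt.fun_add hw'.hasFDerivAt)).fderiv
  rw [Function.comp_def] at hq
  rw [truncation, testDeriv_mulTestFunction le_rfl _ _ _ hx, coe_testDeriv le_top, hq]
  simp only [FunLike.coe_smul, Pi.smul_apply, add_apply, smul_eq_mul]
  ring

theorem setIntegral_testDeriv_truncation_sq_le (hu : ContDiffOn ℝ 1 u Ω)
    (hG' : ∀ s, deriv G s ∈ Icc 0 1) (hη : ∀ x, η x ∈ Icc (0 : ℝ) 1)
    (v : EuclideanSpace ℝ (Fin d)) :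
    ∫ x in Ω, ∂[v] (truncation hG hu η w) x ^ 2 ≤
      4 * (∫ x in Ω, fderiv ℝ u x v * ∂[v] (truncation hG hu η w) x)
        + 2 * (∫ x in Ω, ∂[v] w x ^ 2)
        + 2 * (∫ x in Ω, (G (u x + w x) * ∂[v] η x) ^ 2)
        - 4 * ∫ x in Ω, G (u x + w x) * (fderiv ℝ u x v * ∂[v] η x) := by
  have hmeas := Ω.isOpen.measurableSet
  have hq : ContinuousOn (fun x => G (u x + w x)) Ω :=
    hG.continuous.comp_continuousOn (hu.continuousOn.add w.continuous.continuousOn)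
  have hu' : ContinuousOn (fun x => fderiv ℝ u x v) Ω :=
    (hu.continuousOn_fderiv_of_isOpen Ω.isOpen le_rfl).clm_apply continuousOn_const
  have hcross : Integrable (fun x => fderiv ℝ u x v * ∂[v] (truncation hG hu η w) x)
      (volume.restrict Ω) :=
    (integrable_mul_testFunction (hu'.locallyIntegrableOn hmeas) _).restrict
  have hw : Integrable (fun x => ∂[v] w x ^ 2) (volume.restrict Ω) :=
    (memLp_testFunction _ 2).integrable_sq
  have hcutoff : Integrable (fun x => G (u x + w x) * (fderiv ℝ u x v * ∂[v] η x))
      (volume.restrict Ω) := by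
    simp_rw [← mul_assoc]
    exact (integrable_mul_testFunction ((hq.mul hu').locallyIntegrableOn hmeas) _).restrict
  have hcutoff_sq : Integrable (fun x => (G (u x + w x) * ∂[v] η x) ^ 2) (volume.restrict Ω) :=
    (memLp_testFunction (mulTestFunction _ (contDiffOn_zero.2 hq) (∂[v] η)) 2).integrable_sq
  have hsum := (hcross.const_mul 4).fun_add (hw.const_mul 2)
  have hsum' := hsum.fun_add (hcutoff_sq.const_mul 2)
  simp_rw [← integral_const_mul]
  rw [← integral_add (hcross.const_mul 4) (hw.const_mul 2),
    ← integral_add hsum (hcutoff_sq.const_mul 2), ← integral_sub hsum' (hcutoff.const_mul 4)]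
  refine setIntegral_mono_on (memLp_testFunction _ 2).integrable_sq
    (hsum'.sub (hcutoff.const_mul 4)) hmeas fun x hx => ?_
  rw [testDeriv_truncation hG w hu _ hx]
  linarith [mul_add_add_sq_le (unitInterval.mul_mem (hG' (u x + w x)) (hη x))
    (fderiv ℝ u x v) (∂[v] w x) (G (u x + w x) * ∂[v] η x)]

theorem sum_setIntegral_testDeriv_truncation_sq_le (hu : InnerProductSpace.HarmonicOnNhd u Ω)
    (hu₁ : ContDiffOn ℝ 1 u Ω) (hG' : ∀ s, deriv G s ∈ Icc 0 1) (hη : ∀ x, η x ∈ Icc (0 : ℝ) 1) :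
    ∑ j, ∫ x in Ω, ∂[𝐞 j] (truncation hG hu₁ η w) x ^ 2 ≤
      ∑ j, (2 * (∫ x in Ω, ∂[𝐞 j] w x ^ 2)
        + 2 * (∫ x in Ω, (G (u x + w x) * ∂[𝐞 j] η x) ^ 2)
        - 4 * ∫ x in Ω, G (u x + w x) * (fderiv ℝ u x (𝐞 j) * ∂[𝐞 j] η x)) := by
  refine (Finset.sum_le_sum fun j _ =>
    setIntegral_testDeriv_truncation_sq_le hG w hu₁ hG' hη (𝐞 j)).trans_eq ?_
  simp only [Finset.sum_add_distrib, Finset.sum_sub_distrib, ← Finset.mul_sum]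
  rw [sum_setIntegral_fderiv_mul_testDeriv_eq_zero hu le_rfl, mul_zero, zero_add]

theorem setIntegral_truncation_sq_le (hu : InnerProductSpace.HarmonicOnNhd u Ω)
    (hu₁ : ContDiffOn ℝ 1 u Ω) (hG' : ∀ s, deriv G s ∈ Icc 0 1) (hη : ∀ x, η x ∈ Icc (0 : ℝ) 1)
    (i : Fin d) {R : ℝ} (hR : ∀ x ∈ Ω, |x i| ≤ R) :
    ∫ x in Ω, truncation hG hu₁ η w x ^ 2 ≤
      4 * R ^ 2 * ∑ j, (2 * (∫ x in Ω, ∂[𝐞 j] w x ^ 2)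
        + 2 * (∫ x in Ω, (G (u x + w x) * ∂[𝐞 j] η x) ^ 2)
        - 4 * ∫ x in Ω, G (u x + w x) * (fderiv ℝ u x (𝐞 j) * ∂[𝐞 j] η x)) := by
  refine (setIntegral_testFunction_sq_le le_rfl (ℓ := EuclideanSpace.proj i) (v := 𝐞 i) (by simp)
    hR (truncation hG hu₁ η w)).trans (mul_le_mul_of_nonneg_left ?_ (by positivity))
  exact (Finset.single_le_sum (f := fun j => ∫ x in Ω, ∂[𝐞 j] (truncation hG hu₁ η w) x ^ 2)
    (fun j _ => integral_nonneg fun x => sq_nonneg _) (Finset.mem_univ i)).trans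
    (sum_setIntegral_testDeriv_truncation_sq_le hG w hu hu₁ hG' hη)

end Truncation

variable {G : ℝ → ℝ} {Ψ : EuclideanSpace ℝ (Fin d) → ℝ} {w : ℕ → 𝓓(Ω, ℝ)}
  {g : Fin d → EuclideanSpace ℝ (Fin d) → ℝ}

theorem memLp_of_continuousOn_closure
    (hbdd : Bornology.IsBounded (Ω : Set (EuclideanSpace ℝ (Fin d))))
    (hΨ : ContinuousOn Ψ (closure Ω)) : MemLp Ψ 2 (volume.restrict Ω) := by
  have := isFiniteMeasure_restrict_of_isBounded (μ := volume) hbdd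
  obtain ⟨C, hC⟩ := hbdd.isCompact_closure.exists_bound_of_continuousOn hΨ
  refine .of_bound ((hΨ.mono subset_closure).aestronglyMeasurable Ω.isOpen.measurableSet) C ?_
  filter_upwards [ae_restrict_mem Ω.isOpen.measurableSet] with x hx
  exact hC x (subset_closure hx)

theorem exists_cutoff_comp (hG0 : ∀ s ≤ 0, G s = 0)
    (hbdd : Bornology.IsBounded (Ω : Set (EuclideanSpace ℝ (Fin d))))
    (hΨ : ContinuousOn Ψ (closure Ω)) (hΨ0 : ∀ z ∈ frontier (Ω : Set _), Ψ z < 0) :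
    ∃ η : 𝓓^{1}(Ω, ℝ), (∀ x, η x ∈ Icc (0 : ℝ) 1) ∧
      ∀ x ∈ Ω, G (Ψ x) * η x = G (Ψ x) ∧ ∀ v, G (Ψ x) * ∂[v] η x = 0 := by
  have hK : IsCompact (closure (Ω : Set _) ∩ Ψ ⁻¹' Ici 0) :=
    hbdd.isCompact_closure.of_isClosed_subset
      (hΨ.preimage_isClosed_of_isClosed isClosed_closure isClosed_Ici) inter_subset_left
  have hKΩ : closure (Ω : Set _) ∩ Ψ ⁻¹' Ici 0 ⊆ Ω := fun x hx => by
    by_contra hxΩ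
    exact (hΨ0 x (Ω.isOpen.frontier_eq ▸ ⟨hx.1, hxΩ⟩)).not_ge hx.2
  obtain ⟨η, hη1, hη⟩ := exists_testFunction_eventually_eq_one (n := 1) hK hKΩ
  refine ⟨η, hη, fun x hx => ?_⟩
  rcases le_total (Ψ x) 0 with h | h
  · simp only [hG0 _ h, zero_mul, implies_true, and_self]
  · have hone : η =ᶠ[𝓝 x] fun _ => 1 := hη1 x ⟨subset_closure hx, h⟩
    simp [hone.self_of_nhds, coe_testDeriv le_rfl, hone.fderiv_eq]

theorem TendstoH1.tendstoL2_comp_add (hw : TendstoH1 w (fun x => Ψ x - u x) g)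
    (hΨ : MemLp Ψ 2 (volume.restrict Ω)) (hG : LipschitzWith 1 G) (hG0 : G 0 = 0) :
    TendstoL2 (volume.restrict Ω) (fun n x => G (u x + w n x)) fun x => G (Ψ x) := by
  have hu : MemLp (fun x => -u x) 2 (volume.restrict Ω) :=
    (hw.tendstoL2.memLp_lim.sub hΨ).ae_eq (.of_forall fun x => by simp)
  simpa [add_comm] using (hw.tendstoL2.sub (tendstoL2_const hu)).comp_lipschitzWith hG hG0

theorem setIntegral_comp_sq_le (hG : IsC1PosPart G) (hu : InnerProductSpace.HarmonicOnNhd u Ω)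
    (hbdd : Bornology.IsBounded (Ω : Set (EuclideanSpace ℝ (Fin d))))
    (hΨ : ContinuousOn Ψ (closure Ω)) (hΨ0 : ∀ z ∈ frontier (Ω : Set _), Ψ z < 0)
    (hw : TendstoH1 w (fun x => Ψ x - u x) g) (i : Fin d) {R : ℝ} (hR : ∀ x ∈ Ω, |x i| ≤ R) :
    ∫ x in Ω, G (Ψ x) ^ 2 ≤ 4 * R ^ 2 * ∑ j, 2 * ∫ x in Ω, g j x ^ 2 := by
  have hu₁ : ContDiffOn ℝ 1 u Ω := hu.contDiffOn.of_le (by norm_num)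
  have hu₀ (j) : ContDiffOn ℝ 0 (fun x => fderiv ℝ u x (𝐞 j)) Ω := contDiffOn_zero.2
    ((hu₁.continuousOn_fderiv_of_isOpen Ω.isOpen le_rfl).clm_apply continuousOn_const)
  obtain ⟨η, hη, hGη⟩ := exists_cutoff_comp (fun s => (hG.eq_zero_iff s).2) hbdd hΨ hΨ0
  have hlim := hw.tendstoL2_comp_add (memLp_of_continuousOn_closure hbdd hΨ) hG.lipschitzWith
    ((hG.eq_zero_iff 0).2 le_rfl)
  have hlim_left := (hlim.mul_right (memLp_testFunction η ∞)).tendsto_integral_sq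
  rw [setIntegral_congr_fun Ω.isOpen.measurableSet fun x hx => by rw [(hGη x hx).1]] at hlim_left
  have hlim_sq (j) := (hlim.mul_right (memLp_testFunction (∂[𝐞 j] η) ∞)).tendsto_integral_sq
  have hlim_cross (j) := hlim.tendsto_integral_mul
    (tendstoL2_const (memLp_testFunction (mulTestFunction _ (hu₀ j) (∂[𝐞 j] η)) 2))
  have hsq_zero (j) : ∫ x in Ω, (G (Ψ x) * ∂[𝐞 j] η x) ^ 2 = 0 :=
    setIntegral_eq_zero_of_forall_eq_zero fun x hx => by rw [(hGη x hx).2, sq, zero_mul]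
  have hcross_zero (j) : ∫ x in Ω, G (Ψ x) * mulTestFunction _ (hu₀ j) (∂[𝐞 j] η) x = 0 :=
    setIntegral_eq_zero_of_forall_eq_zero fun x hx => by
      rw [mulTestFunction_apply, mul_left_comm, (hGη x hx).2, mul_zero]
  have hlim_right := (tendsto_finsetSum Finset.univ fun j _ =>
    ((((hw.tendstoL2_grad j).tendsto_integral_sq.const_mul 2).add
      ((hlim_sq j).const_mul 2)).sub ((hlim_cross j).const_mul 4))).const_mul (4 * R ^ 2)
  simp only [hsq_zero, hcross_zero, mul_zero, add_zero, sub_zero] at hlim_right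
  exact le_of_tendsto_of_tendsto' hlim_left hlim_right fun n =>
    setIntegral_truncation_sq_le hG.contDiff (w n) hu hu₁ hG.deriv_mem_Icc hη i hR

/- Subtracting `w n` from both `Ψ` and its `H¹₀` part makes the energy on the right-hand side of
`setIntegral_comp_sq_le` arbitrarily small. -/
theorem setIntegral_comp_sq_eq_zero (hG : IsC1PosPart G)
    (hu : InnerProductSpace.HarmonicOnNhd u Ω) (hd : 0 < d)
    (hbdd : Bornology.IsBounded (Ω : Set (EuclideanSpace ℝ (Fin d))))
    (hΨ : ContinuousOn Ψ (closure Ω)) (hΨ0 : ∀ z ∈ frontier (Ω : Set _), Ψ z < 0)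
    (hw : TendstoH1 w (fun x => Ψ x - u x) g) :
    ∫ x in Ω, G (u x) ^ 2 = 0 := by
  obtain ⟨R, -, hR⟩ := exists_forall_abs_apply_le ⟨0, hd⟩ hbdd
  have hw_zero (n : ℕ) {z} (hz : z ∈ frontier (Ω : Set _)) : w n z = 0 :=
    image_eq_zero_of_notMem_tsupport fun h =>
      (Ω.isOpen.frontier_eq ▸ hz).2 ((w n).tsupport_subset h)
  have hle (n : ℕ) : ∫ x in Ω, G (Ψ x - w n x) ^ 2 ≤
      4 * R ^ 2 * ∑ j, 2 * ∫ x in Ω, (g j x - ∂[𝐞 j] (w n) x) ^ 2 := by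
    refine setIntegral_comp_sq_le (Ψ := fun x => Ψ x - w n x) (w := fun m => w m - w n) hG hu hbdd
      (hΨ.sub (w n).continuous.continuousOn)
      (fun z hz => by simpa only [hw_zero n hz, sub_zero] using hΨ0 z hz) ?_ ⟨0, hd⟩ hR
    simpa only [sub_right_comm] using hw.sub (tendstoH1_const (w n))
  have hlim_left : TendstoL2 (volume.restrict Ω) (fun n x => G (Ψ x - w n x)) fun x => G (u x) := by
    simpa only [sub_sub_cancel] using
      ((tendstoL2_const (memLp_of_continuousOn_closure hbdd hΨ)).sub
        hw.tendstoL2).comp_lipschitzWith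
        hG.lipschitzWith ((hG.eq_zero_iff 0).2 le_rfl)
  have hlim_right := (tendsto_finsetSum Finset.univ fun j _ =>
    ((tendstoL2_const (hw.tendstoL2_grad j).memLp_lim).sub
      (hw.tendstoL2_grad j)).tendsto_integral_sq.const_mul 2).const_mul (4 * R ^ 2)
  refine le_antisymm ((le_of_tendsto_of_tendsto' hlim_left.tendsto_integral_sq hlim_right
    hle).trans_eq ?_) (integral_nonneg fun x => sq_nonneg _)
  simp

theorem nonpos_of_forall_frontier_neg (hd : 0 < d)
    (hbdd : Bornology.IsBounded (Ω : Set (EuclideanSpace ℝ (Fin d))))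
    (hu : InnerProductSpace.HarmonicOnNhd u Ω) (hΨ : ContinuousOn Ψ (closure Ω))
    (hΨ0 : ∀ z ∈ frontier (Ω : Set _), Ψ z < 0) (hΨu : MemH10 Ω fun x => Ψ x - u x) :
    ∀ x ∈ Ω, u x ≤ 0 := by
  obtain ⟨G, hG⟩ := exists_isC1PosPart
  obtain ⟨g, w, hw⟩ := memH10_iff.1 hΨu
  have hGu : MemLp (fun x => G (u x)) 2 (volume.restrict Ω) :=
    hG.lipschitzWith.comp_memLp ((hG.eq_zero_iff 0).2 le_rfl)
      (((memLp_of_continuousOn_closure hbdd hΨ).sub hw.tendstoL2.memLp_lim).ae_eq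
        (.of_forall fun x => sub_sub_cancel ..))
  have hae : (fun x => G (u x)) =ᵐ[volume.restrict Ω] fun _ => 0 := by
    filter_upwards [(integral_eq_zero_iff_of_nonneg (fun x => sq_nonneg _) hGu.integrable_sq).1
      (setIntegral_comp_sq_eq_zero hG hu hd hbdd hΨ hΨ0 hw)] with x hx
    exact pow_eq_zero_iff two_ne_zero |>.1 hx
  have heq := Measure.eqOn_open_of_ae_eq hae Ω.isOpen
    (hG.contDiff.continuous.comp_continuousOn hu.contDiffOn.continuousOn) continuousOn_const
  exact fun x hx => (hG.eq_zero_iff _).1 (heq hx)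

theorem nonpos_of_forall_frontier_nonpos (hd : 0 < d)
    (hbdd : Bornology.IsBounded (Ω : Set (EuclideanSpace ℝ (Fin d))))
    (hu : InnerProductSpace.HarmonicOnNhd u Ω) (hΨ : ContinuousOn Ψ (closure Ω))
    (hΨ0 : ∀ z ∈ frontier (Ω : Set _), Ψ z ≤ 0) (hΨu : MemH10 Ω fun x => Ψ x - u x) :
    ∀ x ∈ Ω, u x ≤ 0 := by
  refine fun x hx => le_of_forall_pos_sub_le fun ε hε => ?_
  refine nonpos_of_forall_frontier_neg (u := u - fun _ => ε) hd hbdd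
    (hu.sub (InnerProductSpace.harmonicOnNhd_const ε)) (hΨ.sub continuousOn_const)
    (fun z hz => (sub_lt_self _ hε).trans_le (hΨ0 z hz)) ?_ x hx
  simpa only [Pi.sub_apply, sub_sub_sub_cancel_right] using hΨu

theorem IsVariationalSolution.le_of_le (hd : 0 < d)
    (hbdd : Bornology.IsBounded (Ω : Set (EuclideanSpace ℝ (Fin d))))
    {φ φ' : C(frontier (Ω : Set (EuclideanSpace ℝ (Fin d))), ℝ)} (hφ : φ ≤ φ')
    {u' : EuclideanSpace ℝ (Fin d) → ℝ} (h : IsVariationalSolution Ω φ u)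
    (h' : IsVariationalSolution Ω φ' u') : ∀ x ∈ Ω, u x ≤ u' x := by
  obtain ⟨hu, Φ, hΦ, hΦφ, hΦu⟩ := h
  obtain ⟨hu', Φ', hΦ', hΦφ', hΦu'⟩ := h'
  have hle : ∀ z ∈ frontier (Ω : Set (EuclideanSpace ℝ (Fin d))), (Φ - Φ') z ≤ 0 := fun z hz => by
    rw [Pi.sub_apply, hΦφ ⟨z, hz⟩, hΦφ' ⟨z, hz⟩]
    exact sub_nonpos.2 (hφ _)
  have hmem : MemH10 Ω fun x => (Φ - Φ') x - (u - u') x := by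
    simpa only [Pi.sub_apply, sub_sub_sub_comm] using hΦu.sub hΦu'
  exact fun x hx => sub_nonpos.1 <|
    nonpos_of_forall_frontier_nonpos hd hbdd (hu.sub hu') (hΦ.sub hΦ') hle hmem x hx

end MaximumPrinciple

theorem corollary2p8_general {d : ℕ} (hd : 0 < d) (Ω : Opens (EuclideanSpace ℝ (Fin d)))
    (hbdd : Bornology.IsBounded (Ω : Set (EuclideanSpace ℝ (Fin d))))
    (φ : C(frontier (Ω : Set (EuclideanSpace ℝ (Fin d))), ℝ))
    (hφ : ∃ K : ℝ≥0, LipschitzWith K φ) :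
    ∃ u : EuclideanSpace ℝ (Fin d) → ℝ,
      IsVariationalSolution Ω φ u ∧
      (∀ u' : EuclideanSpace ℝ (Fin d) → ℝ, IsVariationalSolution Ω φ u' →
        EqOn u' u (Ω : Set (EuclideanSpace ℝ (Fin d)))) ∧
      MemH1 Ω u ∧
      (∫⁻ x in (Ω : Set (EuclideanSpace ℝ (Fin d))), ‖gradient u x‖ₑ ^ 2) < ⊤ := by
  obtain ⟨K, hK⟩ := hφ
  obtain ⟨u, g, hu, hg⟩ := exists_isVariationalSolution hd hbdd hK
  exact ⟨u, hu, fun u' hu' x hx => le_antisymm (hu'.le_of_le hd hbdd le_rfl hu x hx)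
    (hu.le_of_le hd hbdd le_rfl hu' x hx), ⟨g, hg⟩,
    hg.lintegral_gradient_lt_top (hu.1.contDiffOn.of_le (by norm_num))⟩

/-- Lipschitz boundary data `φ` have a variational solution `u_φ`, unique as a function on `Ω`,
and it is in `H¹(Ω)`, i.e. it has finite energy. -/
theorem corollary2p8 {d : ℕ} (hd : 2 ≤ d) (Ω : Opens (EuclideanSpace ℝ (Fin d)))
    (hconn : IsConnected (Ω : Set (EuclideanSpace ℝ (Fin d))))
    (hbdd : Bornology.IsBounded (Ω : Set (EuclideanSpace ℝ (Fin d))))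
    (φ : C(frontier (Ω : Set (EuclideanSpace ℝ (Fin d))), ℝ))
    (hφ : ∃ K : ℝ≥0, LipschitzWith K φ) :
    ∃ u : EuclideanSpace ℝ (Fin d) → ℝ,
      IsVariationalSolution Ω φ u ∧
      (∀ u' : EuclideanSpace ℝ (Fin d) → ℝ, IsVariationalSolution Ω φ u' →
        EqOn u' u (Ω : Set (EuclideanSpace ℝ (Fin d)))) ∧
      MemH1 Ω u ∧
      (∫⁻ x in (Ω : Set (EuclideanSpace ℝ (Fin d))), ‖gradient u x‖ₑ ^ 2) < ⊤ :=
  corollary2p8_general (by omega) Ω hbdd φ hφ
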